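/- Let $\mathcal{T}$ be a triangulation of a 3-manifold (possibly with boundary) with $n$ tetrahedra: a collection of $n$ tetrahedra, some of whose $4n$ triangular faces are affinely identified in pairs, such that the quotient space is a 3-manifold. Faces that are not paired are boundary faces, the others are internal; the degree of an edge of $\mathcal{T}$ is the number of edges of tetrahedra that are identified to form it. A normal surface $S$ in $\mathcal{T}$ is a properly embedded surface that meets each tetrahedron in a finite disjoint collection of normal discs: triangles (four types, each cutting off one vertex) and quadrilaterals (three types, each separating two opposite edges), with corners in the interiors of distinct edges, sides in the interiors of faces and interior in the interior of the tetrahedron. Its vector representation $\mathbf{v}(S)\in\mathbb{R}^{7n}$ lists the numbers of normal discs of each type in each tetrahedron. The Euler characteristic of $S$ is $V-E+F$, where $V,E,F$ are the numbers of vertices, edges and faces of a polygonal decomposition of $S$. Then there is a linear function $\chi\colon\mathbb{R}^{7n}\to\mathbb{R}$ such that, for every normal surface $S$ in $\mathcal{T}$, the normal discs form a polygonal decomposition of $S$ and $\chi(\mathbf{v}(S))$ is the Euler characteristic $V-E+F$ of $S$ computed from it. Explicitly, $\chi(\mathbf{x})=V(\mathbf{x})-E(\mathbf{x})+F(\mathbf{x})$,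 where - $F(\mathbf{x})$ is the sum of all $7n$ coordinates of $\mathbf{x}$; - $E(\mathbf{x})$ is the sum of all coordinates, each multiplied by the total weight of the (three or four) sides of a normal disc of the corresponding type, where a side has weight $1$ if it lies in a boundary face of $\mathcal{T}$ and weight $\tfrac12$ if it lies in an internal face; - $V(\mathbf{x})$ is the sum of all coordinates, each multiplied by the total weight of the (three or four) corners of a normal disc of the corresponding type, where a corner that lies in an edge of $\mathcal{T}$ of degree $d$ has weight $1/d$. -/

import Mathlib

open Set

namespace NormalSurface

noncomputable section

/-! ### Polygonal decompositions and Euler characteristic -/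

/-- `V`, `E`, `F` are the sets of vertices, open edges and open faces (all as subsets of `X`) of a
finite polygonal decomposition of `S ⊆ X`: these cells partition `S`; a vertex is a point; an open
edge is the injective image of an open interval whose two ends go to vertices; an open face is the
injective image of the interior of a convex polygon whose corners `P` go to vertices, and the rest
of whose boundary goes to edges. (Ends of an edge, or sides of a polygon, may be identified.) -/
structure IsPolygonalDecomposition {X : Type*} [TopologicalSpace X] (S : Set X)
    (V E F : Set (Set X)) : Prop where
  finite_vertices : V.Finite
  finite_edges : E.Finite
  finite_faces : F.Finite
  disjoint_VE : Disjoint V E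
  disjoint_VF : Disjoint V F
  disjoint_EF : Disjoint E F
  pairwiseDisjoint : (V ∪ E ∪ F).PairwiseDisjoint id
  sUnion_eq : ⋃₀ (V ∪ E ∪ F) = S
  vertex : ∀ v ∈ V, ∃ x, v = {x}
  edge : ∀ e ∈ E, ∃ γ : ℝ → X, ContinuousOn γ (Icc 0 1) ∧ InjOn γ (Ioo 0 1) ∧
    γ '' Ioo 0 1 = e ∧ γ 0 ∈ ⋃₀ V ∧ γ 1 ∈ ⋃₀ V
  face : ∀ f ∈ F, ∃ (P : Finset (ℝ × ℝ)) (ψ : ℝ × ℝ → X),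
    (interior (convexHull ℝ (P : Set (ℝ × ℝ)))).Nonempty ∧
    ContinuousOn ψ (convexHull ℝ (P : Set (ℝ × ℝ))) ∧
    InjOn ψ (interior (convexHull ℝ (P : Set (ℝ × ℝ)))) ∧
    ψ '' interior (convexHull ℝ (P : Set (ℝ × ℝ))) = f ∧
    (∀ p ∈ frontier (convexHull ℝ (P : Set (ℝ × ℝ))), p ∈ P → ψ p ∈ ⋃₀ V) ∧
    (∀ p ∈ frontier (convexHull ℝ (P : Set (ℝ × ℝ))), p ∉ P → ψ p ∈ ⋃₀ E)

/-- The Euler characteristic `V - E + F` of a decomposition with vertices `V`, edges `E` and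
faces `F`. -/
def eulerCharacteristic {X : Type*} (V E F : Set (Set X)) : ℤ :=
  (V.ncard : ℤ) - E.ncard + F.ncard

/-! ### The tetrahedron and its normal discs -/

/-- The standard tetrahedron, in barycentric coordinates. -/
abbrev Tet : Type := stdSimplex ℝ (Fin 4)

/-- The set of vertices of the tetrahedron spanning the unique open face (of any dimension)
that contains `x`. -/
def supp (x : Tet) : Finset (Fin 4) := Finset.univ.filter fun k => x.1 k ≠ 0

/-- The seven normal disc types: the triangle `Sum.inl v` cuts off the vertex `v`; the
quadrilateral `Sum.inr k` separates the vertices `0, k + 1` from the other two. -/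
abbrev DiscType : Type := Fin 4 ⊕ Fin 3

/-- The vertices on one side of a normal disc of the given type. -/
def DiscType.side : DiscType → Finset (Fin 4)
  | Sum.inl v => {v}
  | Sum.inr k => {0, k.succ}

/-- A disc of type `τ` meets the interior of the edge or face of the tetrahedron spanned by `s`
(an edge in one point, a triangular face in one arc) iff `s` has vertices on both sides. -/
def DiscType.Meets (τ : DiscType) (s : Finset (Fin 4)) : Prop :=
  ¬ s ⊆ τ.side ∧ ¬ s ⊆ τ.sideᶜ

instance (τ : DiscType) (s : Finset (Fin 4)) : Decidable (τ.Meets s) := by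
  unfold DiscType.Meets; infer_instance

/-- The model polygon of a disc type: the product of the simplices spanned by the two sides.
It is a triangle (a point times a triangle) for the triangle types, and a
quadrilateral (a segment times a segment) for the quadrilateral types. -/
def DiscType.model (τ : DiscType) : Set (Tet × Tet) :=
  {z | supp z.1 ⊆ τ.side ∧ supp z.2 ⊆ τ.sideᶜ}

/-- `D` is a normal disc of type `τ` in the tetrahedron: an embedded copy of the model
polygon, with each corner `(a, b)` in the open edge `ab` of the tetrahedron, each open
side in the corresponding open triangular face, and the interior in the open tetrahedron. -/
def IsNormalDisc (τ : DiscType) (D : Set Tet) : Prop :=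
  ∃ φ : Tet × Tet → Tet, ContinuousOn φ τ.model ∧ InjOn φ τ.model ∧ φ '' τ.model = D ∧
    ∀ z ∈ τ.model, supp (φ z) = supp z.1 ∪ supp z.2

/-! ### Triangulations -/

/-- `n` tetrahedra, some of whose faces are affinely identified in pairs. Face `f` of a tetrahedron
is the one opposite vertex `f`. If `glue i f = some (j, σ)`, then face `f` of tetrahedron `i` is
identified with face `σ f` of tetrahedron `j`, each vertex `k ≠ f` with `σ k`;
if `glue i f = none`, it is a boundary face. -/
structure Triangulation (n : ℕ) where
  glue : Fin n → Fin 4 → Option (Fin n × Equiv.Perm (Fin 4))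
  glue_symm : ∀ i f j σ, glue i f = some (j, σ) → glue j (σ f) = some (i, σ⁻¹)
  glue_ne : ∀ i f j σ, glue i f = some (j, σ) → (j, σ f) ≠ (i, f)

namespace Triangulation

variable {n : ℕ}

/-- The face identifications on the disjoint union of the tetrahedra. -/
def Glued (T : Triangulation n) (p q : Fin n × Tet) : Prop :=
  ∃ (f : Fin 4) (σ : Equiv.Perm (Fin 4)), T.glue p.1 f = some (q.1, σ) ∧ p.2.1 f = 0 ∧
    ∀ k, q.2.1 (σ k) = p.2.1 k

/-- The underlying space: the quotient of the disjoint union of the tetrahedra by the equivalence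
relation generated by the face identifications. -/
def Space (T : Triangulation n) : Type := Quot T.Glued

/-- The quotient topology. -/
instance (T : Triangulation n) : TopologicalSpace T.Space :=
  inferInstanceAs (TopologicalSpace (Quot T.Glued))

/-- The map of the `i`th tetrahedron to the underlying space. -/
def incl (T : Triangulation n) (i : Fin n) (x : Tet) : T.Space := Quot.mk T.Glued (i, x)

/-- The identifications that the face gluings induce on the edges of the tetrahedra; `(i, s)` is
the edge of the `i`th tetrahedron with the two vertices in `s`. -/
def EdgeGlued (T : Triangulation n) (p q : Fin n × Finset (Fin 4)) : Prop :=
  ∃ (f : Fin 4) (σ : Equiv.Perm (Fin 4)), T.glue p.1 f = some (q.1, σ) ∧ f ∉ p.2 ∧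
    q.2 = p.2.image σ

/-- The degree of the edge of the triangulation that contains the edge `s` of the `i`th
tetrahedron: the number of edges of tetrahedra that are identified to it. -/
def edgeDegree (T : Triangulation n) (i : Fin n) (s : Finset (Fin 4)) : ℕ :=
  {q | Relation.EqvGen T.EdgeGlued (i, s) q}.ncard

/-! ### Normal surfaces -/

/-- The connected components of the part of `S` in the `i`th tetrahedron. -/
def discs (T : Triangulation n) (S : Set T.Space) (i : Fin n) : Set (Set Tet) :=
  {D | ∃ x ∈ T.incl i ⁻¹' S, D = connectedComponentIn (T.incl i ⁻¹' S) x}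

/-- `S` is a normal surface: it meets each tetrahedron in a finite disjoint collection of normal
discs. (When the underlying space is a 3-manifold, such an `S` is automatically a properly
embedded surface.) -/
def IsNormalSurface (T : Triangulation n) (S : Set T.Space) : Prop :=
  ∀ i, (T.discs S i).Finite ∧ ∀ D ∈ T.discs S i, ∃ τ, IsNormalDisc τ D

/-- The vector representation in `ℝ^{7n}`: the number of normal discs of each type in each
tetrahedron. -/
def vectorRep (T : Triangulation n) (S : Set T.Space) : Fin n × DiscType → ℝ :=
  fun p => ({D ∈ T.discs S p.1 | IsNormalDisc p.2 D}.ncard : ℝ)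

/-- The `k`-dimensional cells of the decomposition of `S` into normal discs, as subsets of the
underlying space: the corners (`k = 0`), open sides (`k = 1`) and interiors (`k = 2`) of the
normal discs, that is, the parts of the normal discs in the open edges, open triangular faces and
interiors of the tetrahedra. -/
def cells (T : Triangulation n) (S : Set T.Space) (k : ℕ) : Set (Set T.Space) :=
  {C | C.Nonempty ∧ ∃ i, ∃ D ∈ T.discs S i, ∃ s : Finset (Fin 4), s.card = k + 2 ∧
    C = T.incl i '' {x ∈ D | supp x = s}}

/-! ### The explicit linear function -/

/-- The sum of all coordinates. -/
def faceSum (_T : Triangulation n) (x : Fin n × DiscType → ℝ) : ℝ :=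
  ∑ i, ∑ τ : DiscType, x (i, τ)

/-- The sum over the sides of normal discs, with weight `1` for a side in a boundary face
and `1/2` for a side in an internal face. -/
def edgeSum (T : Triangulation n) (x : Fin n × DiscType → ℝ) : ℝ :=
  ∑ i, ∑ τ : DiscType, ∑ f : Fin 4,
    if τ.Meets {f}ᶜ then (if T.glue i f = none then (1 : ℝ) else 1 / 2) * x (i, τ) else 0

/-- The sum over the corners of normal discs, with weight `1/d` for a corner in an
edge of degree `d`. -/
def vertexSum (T : Triangulation n) (x : Fin n × DiscType → ℝ) : ℝ :=
  ∑ i, ∑ τ : DiscType, ∑ s ∈ Finset.powersetCard 2 (Finset.univ : Finset (Fin 4)),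
    if τ.Meets s then 1 / (T.edgeDegree i s : ℝ) * x (i, τ) else 0

end Triangulation

end

end NormalSurface

/-! Counting cells is a matter of multiplicities. Each cell of the decomposition is the image of the
part of a normal disc in one open simplex (edge, face or interior) of a tetrahedron. The simplices
identified with a given one form a class of some size d. Suppose that every open simplex of
dimension at least one embeds in the quotient (`eq_of_incl_eq`). Then a cell comes from exactly one
disc in each of the d members of its class and from nothing else (`exists_disc_of_cell`), so pieces
of weight 1/d count each cell once (`sum_weight_cell`). Exchanging the sums and sorting the discs by
type makes the number of cells of each dimension linear in the vector representation
(`ncard_cells`). For tetrahedra d = 1, and for triangular faces d is 1 or 2 according to whether the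
face is boundary or internal, which gives the stated weights.

The embedding can fail only for an edge that is identified with itself in reverse; two corners of
discs on such an edge could then be one vertex, and the count of vertices would be wrong. This is
where the manifold hypothesis enters (`not_flagEquiv_rev`). Heuristically, the midpoint of a
reversed edge has a neighbourhood that is a cone on a projective plane, whereas a punctured ball or
half-ball of dimension 3 is simply connected.

The obstruction is made concrete by a double cover. Around the midpoint there is a vector field
`oddField`, defined on each tetrahedron up to a sign that depends on the orientation of the edge,
compatible with the gluings and vanishing near the midpoint only at the midpoint itself. Its square
v vᵀ does not see the sign, so it descends to a continuous field of rank-one matrices on the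
punctured neighbourhood. Since nonzero vectors doubly cover the rank-one matrices, simple
connectivity yields a continuous square root (`exists_hasRootOn_diff_singleton`). The sign of the
inner product of this root with `oddField` is constant along arcs around the edge and across
gluings, hence the same for all equivalent flags; but it changes when the edge is reversed.

The rest is the decomposition itself (`isPolygonalDecomposition_cells`): a disc is parametrized by a
product of two simplices, whose open faces correspond to the open simplices that the disc meets, and
the cells through identified points coincide (`cellAt_eq_of_incl_eq`). -/

namespace NormalSurface

noncomputable section

/-! ### Square roots of fields of rank-one matrices -/

/-- The symmetric matrix `v vᵀ`. -/
def outer {ι : Type*} (v : ι → ℝ) : ι → ι → ℝ := fun i j => v i * v j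

/-- The set of matrices `v vᵀ` with `v ≠ 0`. -/
def rankOne (ι : Type*) : Set (ι → ι → ℝ) := {M | ∃ v : ι → ℝ, v ≠ 0 ∧ M = outer v}

theorem outer_neg {ι : Type*} (v : ι → ℝ) : outer (-v) = outer v := by
  funext i j; simp [outer]

/-- A diagonal entry with v k ≠ 0 determines w k up to sign, and row k then carries that sign to all
other coordinates. -/
theorem outer_eq_iff {ι : Type*} {v w : ι → ℝ} : outer v = outer w ↔ v = w ∨ v = -w := by
  constructor
  · intro h
    by_cases hv : v = 0
    · left
      subst hv
      funext i
      have := congrFun (congrFun h i) i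
      simp only [outer, Pi.zero_apply, mul_zero] at this
      simpa using (mul_self_eq_zero.1 this.symm).symm
    · obtain ⟨k, hk⟩ := Function.ne_iff.1 hv
      have hkk : v k * v k = w k * w k := congrFun (congrFun h k) k
      rcases mul_self_eq_mul_self_iff.1 hkk with h1 | h1
      · left; funext j
        have : v k * v j = w k * w j := congrFun (congrFun h k) j
        rw [← h1] at this
        exact mul_left_cancel₀ hk this
      · right; funext j
        have : v k * v j = w k * w j := congrFun (congrFun h k) j
        have h2 : w k = - v k := by linarith
        rw [h2] at this
        apply mul_left_cancel₀ hk
        simp only [Pi.neg_apply]; linarith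
  · rintro (rfl | rfl)
    · rfl
    · exact outer_neg w

/-- The double cover of the rank-one matrices by the nonzero vectors. -/
def outerCover (ι : Type*) (v : {v : ι → ℝ // v ≠ 0}) : rankOne ι :=
  ⟨outer v.1, v.1, v.2, rfl⟩

/-- Over the open set where the entry M k k is positive, the sheets are told apart by the sign s of
v k, and v is recovered from M and s as s · M k j / √(M k k). These sets cover all rank-one matrices
as k varies. -/
theorem isCoveringMap_outerCover (ι : Type*) : IsCoveringMap (outerCover ι) := by
  intro M
  obtain ⟨M, v₀, hv₀, rfl⟩ := M
  obtain ⟨k, hk⟩ := Function.ne_iff.1 hv₀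
  let I : Type := ({1, -1} : Set ℝ)
  have hfin : Finite I := inferInstanceAs (Finite ({1, -1} : Set ℝ))
  have hdisc : DiscreteTopology I := inferInstanceAs (DiscreteTopology ({1, -1} : Set ℝ))
  have hcM : ∀ j, Continuous fun M : rankOne ι => M.1 k j :=
    fun j => (continuous_apply_apply k j).comp continuous_subtype_val
  have hcv : ∀ j, Continuous fun v : {v : ι → ℝ // v ≠ 0} => v.1 j :=
    fun j => (continuous_apply j).comp continuous_subtype_val
  let U : Set (rankOne ι) := {M | 0 < M.1 k k}
  have hU : IsOpen U := isOpen_lt continuous_const (hcM k)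
  have hcont : Continuous (outerCover ι) := by
    unfold outerCover outer
    exact Continuous.subtype_mk (continuous_pi fun i => continuous_pi fun j => (hcv i).mul (hcv j)) _
  have hsgn : ∀ t : ℝ, t ≠ 0 → t / |t| ∈ ({1, -1} : Set ℝ) := by
    intro t ht
    rcases lt_or_gt_of_ne ht with h | h
    · right; rw [abs_of_neg h, div_neg, div_self ht]; rfl
    · left; rw [abs_of_pos h, div_self ht]
  have hne : ∀ v : outerCover ι ⁻¹' U, v.1.1 k ≠ 0 := by
    rintro ⟨v, hv⟩ h
    have hv' : 0 < v.1 k * v.1 k := hv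
    exact hv'.ne' (mul_self_eq_zero.2 h)
  have hII : ∀ s : I, s.1 * s.1 = 1 := by
    rintro ⟨s, rfl | rfl⟩ <;> norm_num
  have hout : ∀ (M : U) (s : I),
      outer (fun j => s.1 * M.1.1 k j / √(M.1.1 k k)) = M.1.1 := by
    rintro ⟨⟨M, w, hw, rfl⟩, hM⟩ s
    have hM' : 0 < w k * w k := hM
    funext i j
    simp only [outer]
    rw [div_mul_div_comm, Real.mul_self_sqrt hM'.le, div_eq_iff hM'.ne']
    linear_combination (w k * w i * w k * w j) * hII s
  refine IsEvenlyCovered.to_isEvenlyCovered_preimage (I := I) ⟨hdisc, U, mul_self_pos.2 hk, hU, hU.preimage hcont, ?_⟩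
  refine ⟨{ toFun := fun v => (⟨outerCover ι v.1, v.2⟩, ⟨v.1.1 k / |v.1.1 k|, hsgn _ (hne v)⟩)
            invFun := fun q => ⟨⟨fun j => q.2.1 * q.1.1.1 k j / √(q.1.1.1 k k), ?_⟩, ?_⟩
            left_inv := ?_
            right_inv := ?_
            continuous_toFun := ?_
            continuous_invFun := ?_ }, fun v => rfl⟩
  · intro h0
    have h1 := hout q.1 q.2
    have h2 : 0 < q.1.1.1 k k := q.1.2
    rw [h0] at h1
    rw [← h1] at h2
    simp [outer] at h2
  · change 0 < (outer (fun j => q.2.1 * q.1.1.1 k j / √(q.1.1.1 k k))) k k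
    rw [hout q.1 q.2]
    exact q.1.2
  · intro v
    apply Subtype.ext; apply Subtype.ext
    funext j
    have h := hne v
    change v.1.1 k / |v.1.1 k| * (v.1.1 k * v.1.1 j) / √(v.1.1 k * v.1.1 k) = v.1.1 j
    rw [Real.sqrt_mul_self_eq_abs]
    have h' : |v.1.1 k| ≠ 0 := abs_ne_zero.2 h
    field_simp
    rw [sq_abs]
  · rintro ⟨M, s⟩
    have h1 := hout M s
    have hM : 0 < M.1.1 k k := M.2
    refine Prod.ext (Subtype.ext (Subtype.ext h1)) (Subtype.ext ?_)
    change s.1 * M.1.1 k k / √(M.1.1 k k) / |s.1 * M.1.1 k k / √(M.1.1 k k)| = s.1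
    have h3 : 0 < √(M.1.1 k k) := Real.sqrt_pos.2 hM
    have h4 : |s.1| = 1 := by
      have := hII s
      rcases s with ⟨s, rfl | rfl⟩ <;> simp
    rw [mul_div_assoc, abs_mul, h4, one_mul, abs_of_pos (by positivity)]
    field_simp
  · refine Continuous.prodMk ?_ ?_
    · exact Continuous.subtype_mk (hcont.comp continuous_subtype_val) _
    · refine Continuous.subtype_mk ?_ _
      have h := (hcv k).comp (continuous_subtype_val (p := (· ∈ outerCover ι ⁻¹' U)))
      exact h.div h.abs fun v => abs_ne_zero.2 (hne v)
  · refine Continuous.subtype_mk (Continuous.subtype_mk ?_ _) _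
    refine continuous_pi fun j => ?_
    have hI : Continuous fun q : U × I => q.2.1 :=
      (continuous_subtype_val (p := (· ∈ ({1, -1} : Set ℝ)))).comp continuous_snd
    have hM : ∀ j, Continuous fun q : U × I => q.1.1.1 k j :=
      fun j => (hcM j).comp (continuous_subtype_val.comp continuous_fst)
    exact Continuous.div (hI.mul (hM j)) (Real.continuous_sqrt.comp (hM k)) fun q => (Real.sqrt_pos.2 q.1.2).ne'

/-- A continuous vector field `r` on `s` with `G = r rᵀ`. -/
def HasRootOn {X ι : Type*} [TopologicalSpace X] (G : X → ι → ι → ℝ) (s : Set X) : Prop :=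
  ∃ r : X → ι → ℝ, ContinuousOn r s ∧ ∀ x ∈ s, G x = outer (r x)

/-- Contracting the star to its centre gives a homotopy from a constant map to G. Homotopy lifting
along the double cover, from a constant lift, ends in a root of G. -/
theorem hasRootOn_of_starConvex {E ι : Type*} [AddCommGroup E] [Module ℝ E] [TopologicalSpace E]
    [ContinuousAdd E] [ContinuousSMul ℝ E]
    {G : E → ι → ι → ℝ} {s : Set E} {c : E} (hs : StarConvex ℝ c s) (hc : c ∈ s)
    (hG : ContinuousOn G s) (hG1 : ∀ x ∈ s, G x ∈ rankOne ι) : HasRootOn G s := by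
  let H : C(unitInterval × s, rankOne ι) :=
    ⟨fun q => ⟨G ((1 - q.1.1) • c + q.1.1 • q.2.1), hG1 _ (hs q.2.2 (by linarith [q.1.2.2]) q.1.2.1 (by ring))⟩, by
      refine Continuous.subtype_mk ?_ _
      refine hG.comp_continuous (by fun_prop) fun q => hs q.2.2 (by linarith [q.1.2.2]) q.1.2.1 (by ring)⟩
  obtain ⟨v, hv, hv'⟩ := hG1 c hc
  have H0 : ∀ a, H (0, a) = outerCover ι (ContinuousMap.const s ⟨v, hv⟩ a) := by
    intro a
    apply Subtype.ext
    simp [H, outerCover, hv']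
  let L := (isCoveringMap_outerCover ι).liftHomotopy H _ H0
  have hL := (isCoveringMap_outerCover ι).liftHomotopy_lifts H _ H0
  classical
  refine ⟨fun x => if h : x ∈ s then (L (1, ⟨x, h⟩)).1 else 0, ?_, ?_⟩
  · rw [continuousOn_iff_continuous_domRestrict]
    have : Continuous fun x : s => (L (1, x)).1 := by fun_prop
    convert this using 2 with x
    simp [domRestrict]
  · intro x hx
    have := congrArg Subtype.val (congrFun hL (1, ⟨x, hx⟩))
    simp [H, outerCover] at this
    simp only [hx, dif_pos]
    exact this.symm

/-- On the overlap the two roots agree up to a sign. The roots do not vanish there, so the sets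
where the sign is + and − are disjoint and relatively closed; preconnectedness leaves only one of
them, and one root can be negated to match the other. -/
theorem HasRootOn.union {X ι : Type*} [TopologicalSpace X] {G : X → ι → ι → ℝ} {K U V : Set X}
    (hU : IsOpen U) (hV : IsOpen V) (hG1 : ∀ x ∈ K ∩ (U ∪ V), G x ∈ rankOne ι)
    (h1 : HasRootOn G (K ∩ U)) (h2 : HasRootOn G (K ∩ V))
    (hc : IsPreconnected (K ∩ (U ∩ V))) : HasRootOn G (K ∩ (U ∪ V)) := by
  obtain ⟨r, hr, hr'⟩ := h1
  obtain ⟨t, ht, ht'⟩ := h2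
  have key : ∃ t' : X → ι → ℝ, ContinuousOn t' (K ∩ V) ∧ (∀ x ∈ K ∩ V, G x = outer (t' x)) ∧
      ∀ x ∈ K ∩ (U ∩ V), r x = t' x := by
    have hne : ∀ x ∈ K ∩ (U ∩ V), r x ≠ 0 := by
      rintro x ⟨hK, hxU, hxV⟩ h0
      obtain ⟨v, hv, hv'⟩ := hG1 x ⟨hK, Or.inl hxU⟩
      rw [hr' x ⟨hK, hxU⟩, h0] at hv'
      rcases outer_eq_iff.1 hv' with h | h
      · exact hv h.symm
      · exact hv (by simpa using h.symm)
    have hpm : ∀ x ∈ K ∩ (U ∩ V), r x = t x ∨ r x = - t x := by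
      rintro x ⟨hK, hxU, hxV⟩
      exact outer_eq_iff.1 ((hr' x ⟨hK, hxU⟩).symm.trans (ht' x ⟨hK, hxV⟩))
    have hrc : ContinuousOn r (K ∩ (U ∩ V)) := hr.mono fun x hx => ⟨hx.1, hx.2.1⟩
    have htc : ContinuousOn t (K ∩ (U ∩ V)) := ht.mono fun x hx => ⟨hx.1, hx.2.2⟩
    rcases (K ∩ (U ∩ V)).eq_empty_or_nonempty with hE | ⟨x₀, hx₀⟩
    · exact ⟨t, ht, ht', by simp [hE]⟩
    have hcl := isPreconnected_closed_iff.1 (isPreconnected_iff_preconnectedSpace.1 hc).isPreconnected_univ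
      {x : ↥(K ∩ (U ∩ V)) | r x = t x} {x : ↥(K ∩ (U ∩ V)) | r x = - t x}
      (isClosed_eq hrc.domRestrict htc.domRestrict) (isClosed_eq hrc.domRestrict htc.domRestrict.neg)
      (fun x _ => hpm x x.2)
    have hno : ¬ ((∃ x ∈ K ∩ (U ∩ V), r x = t x) ∧ ∃ x ∈ K ∩ (U ∩ V), r x = - t x) := by
      rintro ⟨⟨x, hx, hx'⟩, ⟨y, hy, hy'⟩⟩
      obtain ⟨z, -, hz1, hz2⟩ := hcl ⟨⟨x, hx⟩, trivial, hx'⟩ ⟨⟨y, hy⟩, trivial, hy'⟩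
      have hz1' : r z = t z := hz1
      have hz2' : r z = - t z := hz2
      refine hne z z.2 ?_
      rw [← hz1'] at hz2'
      exact self_eq_neg.1 hz2'
    by_cases hx : ∃ x ∈ K ∩ (U ∩ V), r x = t x
    · refine ⟨t, ht, ht', fun x hx' => (hpm x hx').resolve_right fun h => hno ⟨hx, x, hx', h⟩⟩
    · refine ⟨-t, ht.neg, fun x hx => ?_, fun x hx' => (hpm x hx').resolve_left fun h => hx ⟨x, hx', h⟩⟩
      rw [Pi.neg_apply, outer_neg, ht' x hx]
  obtain ⟨t', ht1, ht2, ht3⟩ := key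
  classical
  refine ⟨fun x => if x ∈ U then r x else t' x, ?_, ?_⟩
  · rintro x ⟨hK, hx⟩
    by_cases hxU : x ∈ U
    · have h4 : ContinuousWithinAt r (K ∩ (U ∪ V)) x :=
        (hr x ⟨hK, hxU⟩).mono_of_mem_nhdsWithin
          (by
            refine Filter.mem_of_superset (Filter.inter_mem self_mem_nhdsWithin (mem_nhdsWithin_of_mem_nhds (hU.mem_nhds hxU))) ?_
            rintro y ⟨hy1, hy2⟩
            exact ⟨hy1.1, hy2⟩)
      refine h4.congr_of_eventuallyEq ?_ (by simp [hxU])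
      filter_upwards [mem_nhdsWithin_of_mem_nhds (hU.mem_nhds hxU)] with y hy
      simp [hy]
    · have hxV : x ∈ V := hx.resolve_left hxU
      have h4 : ContinuousWithinAt t' (K ∩ (U ∪ V)) x :=
        (ht1 x ⟨hK, hxV⟩).mono_of_mem_nhdsWithin
          (by
            refine Filter.mem_of_superset (Filter.inter_mem self_mem_nhdsWithin (mem_nhdsWithin_of_mem_nhds (hV.mem_nhds hxV))) ?_
            rintro y ⟨hy1, hy2⟩
            exact ⟨hy1.1, hy2⟩)
      refine h4.congr_of_eventuallyEq ?_ (by simp [hxU])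
      filter_upwards [mem_nhdsWithin_of_mem_nhds (hV.mem_nhds hxV), self_mem_nhdsWithin] with y hy hy'
      by_cases hyU : y ∈ U
      · simp only [hyU, if_true]; exact ht3 y ⟨hy'.1, hyU, hy⟩
      · simp [hyU]
  · rintro x ⟨hK, hx⟩
    by_cases hxU : x ∈ U
    · simp only [hxU, if_true]; exact hr' x ⟨hK, hxU⟩
    · simp only [hxU, if_false]; exact ht2 x ⟨hK, hx.resolve_left hxU⟩

/-! ### Roots near a point of a 3-manifold -/

/-- A van Kampen argument: the punctured half-box is the union of the complements of two opposite
rays from y. Each is star-shaped, and they meet in the complement of a line, which is connected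
because the dimension is 3. The rays are parallel to the boundary plane, so y may lie on it. -/
theorem hasRootOn_halfBox_diff_singleton {ι : Type*} {y : EuclideanSpace ℝ (Fin 3)} {r : ℝ} (hr : 0 < r)
    (hy : 0 ≤ y 0) {G : EuclideanSpace ℝ (Fin 3) → ι → ι → ℝ}
    (hG : ContinuousOn G ({x | 0 ≤ x 0 ∧ ∀ i, |x i - y i| < r} \ {y}))
    (hG1 : ∀ x ∈ {x : EuclideanSpace ℝ (Fin 3) | 0 ≤ x 0 ∧ ∀ i, |x i - y i| < r} \ {y}, G x ∈ rankOne ι) :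
    HasRootOn G ({x | 0 ≤ x 0 ∧ ∀ i, |x i - y i| < r} \ {y}) := by
  set K : Set (EuclideanSpace ℝ (Fin 3)) := {x | 0 ≤ x 0 ∧ ∀ i, |x i - y i| < r} with hK
  have hKc : Convex ℝ K := by
    have : K = {x | 0 ≤ x 0} ∩ ⋂ i, ({x | x i < y i + r} ∩ {x | y i - r < x i}) := by
      ext x
      simp only [hK, mem_ofPred_eq, mem_inter_iff, mem_iInter, abs_lt]
      refine and_congr_right fun _ => forall_congr' fun i => ⟨fun h => ⟨by linarith [h.2], by linarith [h.1]⟩,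
        fun h => ⟨by linarith [h.2], by linarith [h.1]⟩⟩
    rw [this]
    have hl : ∀ i, IsLinearMap ℝ fun x : EuclideanSpace ℝ (Fin 3) => x i :=
      fun i => ⟨fun _ _ => rfl, fun _ _ => rfl⟩
    exact (convex_halfSpace_ge (hl 0) 0).inter (convex_iInter fun i =>
      (convex_halfSpace_lt (hl i) _).inter (convex_halfSpace_gt (hl i) _))
  have hcoord : ∀ i, Continuous fun x : EuclideanSpace ℝ (Fin 3) => x i := fun i => by fun_prop
  -- the complement of a closed ray from `y` in the direction `σ • e₂`
  let U : ℝ → Set (EuclideanSpace ℝ (Fin 3)) := fun σ => {x | x 0 ≠ y 0 ∨ x 1 ≠ y 1 ∨ σ * (x 2 - y 2) < 0}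
  have hU : ∀ σ, IsOpen (U σ) := fun σ =>
    (isOpen_ne_fun (hcoord 0) continuous_const).union ((isOpen_ne_fun (hcoord 1) continuous_const).union
      (isOpen_lt (continuous_const.mul ((hcoord 2).sub continuous_const)) continuous_const))
  have hy' : ∀ σ, y ∉ U σ := fun σ h => by simp [U] at h
  have hroot : ∀ σ : ℝ, |σ| = 1 → HasRootOn G (K ∩ U σ) := by
    intro σ hσ
    have hσ2 : σ * σ = 1 := by rw [← abs_mul_abs_self, hσ, one_mul]
    -- The centre of the star lies on the opposite ray, so that a segment from c to a point off the
    -- removed ray never meets that ray.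
    let c : EuclideanSpace ℝ (Fin 3) := !₂[y 0, y 1, y 2 - σ * (r / 2)]
    have hc2 : c 2 - y 2 = - (σ * (r/2)) := by simp [c]
    have hcK : c ∈ K := by
      refine ⟨by simpa [c] using hy, fun i => ?_⟩
      fin_cases i
      · simpa [c] using hr
      · simpa [c] using hr
      · change |c 2 - y 2| < r
        rw [hc2, abs_neg, abs_mul, hσ, one_mul, abs_of_pos (by positivity)]; linarith
    have hcU : c ∈ U σ := Or.inr (Or.inr (by rw [hc2]; nlinarith))
    have hsub : K ∩ U σ ⊆ K \ {y} := fun x hx => ⟨hx.1, fun h => hy' σ (h ▸ hx.2)⟩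
    refine hasRootOn_of_starConvex (c := c) ?_ ⟨hcK, hcU⟩ (hG.mono hsub) fun x hx => hG1 x (hsub hx)
    intro x hx a b ha hb hab
    refine ⟨hKc hcK hx.1 ha hb hab, ?_⟩
    have e0 : (a • c + b • x) 0 - y 0 = b * (x 0 - y 0) := by
      have : (a • c + b • x) 0 = a * y 0 + b * x 0 := by simp [c]
      rw [this]; linear_combination (y 0) * hab
    have e1 : (a • c + b • x) 1 - y 1 = b * (x 1 - y 1) := by
      have : (a • c + b • x) 1 = a * y 1 + b * x 1 := by simp [c]
      rw [this]; linear_combination (y 1) * hab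
    have e2 : σ * ((a • c + b • x) 2 - y 2) = - (a * (r / 2)) + b * (σ * (x 2 - y 2)) := by
      have : (a • c + b • x) 2 = a * (y 2 - σ * (r / 2)) + b * x 2 := by simp [c]
      rw [this]; linear_combination (σ * y 2) * hab - a * (r / 2) * hσ2
    rcases hb.eq_or_lt with rfl | hb
    · right; right
      rw [e2]
      have : a = 1 := by linarith
      subst this; linarith
    · rcases hx.2 with h | h | h
      · left; rw [← sub_ne_zero, e0]; exact mul_ne_zero hb.ne' (sub_ne_zero.2 h)
      · right; left; rw [← sub_ne_zero, e1]; exact mul_ne_zero hb.ne' (sub_ne_zero.2 h)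
      · right; right; rw [e2]; nlinarith [mul_pos hb (neg_pos.2 h)]
  have hKU : K ∩ (U 1 ∪ U (-1)) = K \ {y} := by
    ext x
    constructor
    · rintro ⟨hx, hx'⟩
      refine ⟨hx, fun h => ?_⟩
      rw [mem_singleton_iff] at h
      subst h
      exact hx'.elim (hy' _) (hy' _)
    · rintro ⟨hx, hx'⟩
      refine ⟨hx, ?_⟩
      by_contra h
      simp only [U, mem_union, mem_ofPred_eq, not_or, not_not, not_lt] at h
      refine hx' ?_
      ext i
      fin_cases i
      · exact h.1.1
      · exact h.1.2.1
      · change x 2 = y 2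
        linarith [h.1.2.2, h.2.2.2]
  rw [← hKU]
  refine HasRootOn.union (hU _) (hU _) (by rwa [hKU]) (hroot 1 (by simp)) (hroot (-1) (by simp)) ?_
  -- The complement of the line is covered by four convex pieces, on which one of the first two
  -- coordinates lies strictly to one side of that of y.
  let A : Fin 2 → ℝ → Set (EuclideanSpace ℝ (Fin 3)) := fun i σ => K ∩ {x | 0 < σ * (x i.castSucc - y i.castSucc)}
  have hA : ∀ i σ, IsPreconnected (A i σ) := by
    intro i σ
    have hl : IsLinearMap ℝ fun x : EuclideanSpace ℝ (Fin 3) => σ * x i.castSucc :=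
      ⟨fun _ _ => mul_add _ _ _, fun _ _ => mul_left_comm _ _ _⟩
    have : A i σ = K ∩ {x | σ * y i.castSucc < σ * x i.castSucc} := by
      ext x; simp only [A, mem_inter_iff, mem_ofPred_eq, mul_sub, sub_pos]
    rw [this]
    exact (hKc.inter (convex_halfSpace_gt hl _)).isPreconnected
  have hL : K ∩ (U 1 ∩ U (-1)) = (A 1 1 ∪ A 0 1) ∪ (A 1 (-1) ∪ A 0 (-1)) := by
    ext x
    simp only [A, U, mem_inter_iff, mem_union, mem_ofPred_eq]
    constructor
    · rintro ⟨hx, h1, h2⟩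
      simp only [hx, true_and]
      by_cases h3 : x 0 = y 0
      · by_cases h4 : x 1 = y 1
        · simp only [h3, h4, ne_eq, not_true, false_or] at h1 h2
          linarith
        · rcases lt_or_gt_of_ne h4 with h | h
          · right; left; change 0 < -1 * (x 1 - y 1); linarith
          · left; left; change 0 < 1 * (x 1 - y 1); linarith
      · rcases lt_or_gt_of_ne h3 with h | h
        · right; right; change 0 < -1 * (x 0 - y 0); linarith
        · left; right; change 0 < 1 * (x 0 - y 0); linarith
    · have e0 : x (Fin.castSucc (0 : Fin 2)) = x 0 := rfl
      have e1 : x (Fin.castSucc (1 : Fin 2)) = x 1 := rfl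
      have f0 : y (Fin.castSucc (0 : Fin 2)) = y 0 := rfl
      have f1 : y (Fin.castSucc (1 : Fin 2)) = y 1 := rfl
      rw [e0, e1, f0, f1]
      rintro ((⟨hx, h⟩ | ⟨hx, h⟩) | (⟨hx, h⟩ | ⟨hx, h⟩))
      · have : x 1 ≠ y 1 := fun h' => by rw [h'] at h; simp at h
        exact ⟨hx, Or.inr (Or.inl this), Or.inr (Or.inl this)⟩
      · have : x 0 ≠ y 0 := fun h' => by rw [h'] at h; simp at h
        exact ⟨hx, Or.inl this, Or.inl this⟩
      · have : x 1 ≠ y 1 := fun h' => by rw [h'] at h; simp at h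
        exact ⟨hx, Or.inr (Or.inl this), Or.inr (Or.inl this)⟩
      · have : x 0 ≠ y 0 := fun h' => by rw [h'] at h; simp at h
        exact ⟨hx, Or.inl this, Or.inl this⟩
  rw [hL]
  have hr2 : |r / 2| < r := by rw [abs_of_pos (by positivity)]; linarith
  have hmem : ∀ (p : ℝ) (σ : ℝ), 0 ≤ p → |p - y 0| < r → |σ| = 1 →
      !₂[p, y 1 + σ * (r / 2), y 2] ∈ A 1 σ := by
    intro p σ hp hp' hσ
    refine ⟨⟨by simpa using hp, fun i => ?_⟩, ?_⟩
    · fin_cases i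
      · simpa using hp'
      · change |y 1 + σ * (r / 2) - y 1| < r
        rw [add_sub_cancel_left, abs_mul, hσ, one_mul]; exact hr2
      · simpa using hr
    · change 0 < σ * (y 1 + σ * (r / 2) - y 1)
      have hσ2 : σ * σ = 1 := by rw [← abs_mul_abs_self, hσ, one_mul]
      nlinarith
  have hmem0 : ∀ (p : ℝ) (σ τ : ℝ), 0 ≤ p → |p - y 0| < r → |σ| = 1 → 0 < τ * (p - y 0) →
      !₂[p, y 1 + σ * (r / 2), y 2] ∈ A 0 τ := by
    intro p σ τ hp hp' hσ h
    exact ⟨(hmem p σ hp hp' hσ).1, h⟩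
  have hp0 : 0 ≤ y 0 + r / 2 := by positivity
  have hp1 : |y 0 + r / 2 - y 0| < r := by rwa [add_sub_cancel_left]
  have hp2 : 0 < 1 * (y 0 + r / 2 - y 0) := by linarith
  have h1 : IsPreconnected (A 1 1 ∪ A 0 1) :=
    IsPreconnected.union _ (hmem _ 1 hp0 hp1 (by simp)) (hmem0 _ 1 1 hp0 hp1 (by simp) hp2) (hA _ _) (hA _ _)
  have h2 : IsPreconnected (A 1 (-1) ∪ A 0 (-1)) := by
    -- If y is on the boundary, nothing lies beyond it in the negative first direction. This piece
    -- is therefore optional, and the final union is joined through `A 0 1`, which is never empty.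
    rcases (A 0 (-1)).eq_empty_or_nonempty with h | ⟨x, hx, hx'⟩
    · rw [h, union_empty]; exact hA _ _
    · exact IsPreconnected.union _ (hmem _ (-1) hx.1 (hx.2 0) (by simp))
        (hmem0 _ (-1) (-1) hx.1 (hx.2 0) (by simp) hx') (hA _ _) (hA _ _)
  exact IsPreconnected.union _ (Or.inr (hmem0 _ (-1) 1 hp0 hp1 (by simp) hp2))
    (Or.inl (hmem _ (-1) hp0 hp1 (by simp))) h1 h2

open Topology Manifold in
-- In a chart at m the statement becomes the one for a half-box, whether m is an interior or a
-- boundary point.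
theorem exists_hasRootOn_diff_singleton {X ι : Type*} [TopologicalSpace X]
    [ChartedSpace (EuclideanHalfSpace 3) X] {m : X} {W : Set X} (hW : IsOpen W) (hm : m ∈ W)
    {G : X → ι → ι → ℝ} (hG : ContinuousOn G W) (hG1 : ∀ x ∈ W, x ≠ m → G x ∈ rankOne ι) :
    ∃ M ⊆ W, IsOpen M ∧ m ∈ M ∧ HasRootOn G (M \ {m}) := by
  let e := chartAt (EuclideanHalfSpace 3) m
  let I := 𝓡∂ 3
  have hme : m ∈ e.source := mem_chart_source _ m
  have hIs : ∀ x : EuclideanSpace ℝ (Fin 3), 0 ≤ x 0 → I (I.symm x) = x := fun x hx =>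
    I.right_inv (by rw [range_modelWithCornersEuclideanHalfSpace]; exact hx)
  have hI0 : ∀ x, 0 ≤ (I x) 0 := fun x => x.2
  let y := I (e m)
  let T := e.target ∩ e.symm ⁻¹' W
  have hT : IsOpen T := e.isOpen_inter_preimage_symm hW
  have hyT : y ∈ I.symm ⁻¹' T := by
    constructor
    · change I.symm (I (e m)) ∈ e.target
      rw [I.left_inv]; exact e.map_source hme
    · change e.symm (I.symm (I (e m))) ∈ W
      rwa [I.left_inv, e.left_inv hme]
  -- A box is a ball of the sup norm, so openness is read off in the plain product `Fin 3 → ℝ`.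
  obtain ⟨r, hr, hrT⟩ : ∃ r > 0, {x : EuclideanSpace ℝ (Fin 3) | ∀ i, |x i - y i| < r} ⊆ I.symm ⁻¹' T := by
    have hO : IsOpen (WithLp.toLp 2 ⁻¹' (I.symm ⁻¹' T) : Set (Fin 3 → ℝ)) :=
      (hT.preimage I.continuous_symm).preimage (by fun_prop)
    obtain ⟨r, hr, hb⟩ := Metric.isOpen_iff.1 hO (WithLp.ofLp y) hyT
    refine ⟨r, hr, fun x hx => ?_⟩
    have : WithLp.ofLp x ∈ Metric.ball (WithLp.ofLp y) r := by
      rw [Metric.mem_ball, dist_pi_lt_iff hr]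
      exact fun i => hx i
    exact hb this
  set K : Set (EuclideanSpace ℝ (Fin 3)) := {x | 0 ≤ x 0 ∧ ∀ i, |x i - y i| < r} with hK
  let ψ : EuclideanSpace ℝ (Fin 3) → X := fun x => e.symm (I.symm x)
  have hKT : ∀ x ∈ K, I.symm x ∈ T := fun x hx => hrT hx.2
  have hψ : ContinuousOn ψ K :=
    e.continuousOn_symm.comp I.continuous_symm.continuousOn fun x hx => (hKT x hx).1
  have hψW : ∀ x ∈ K, ψ x ∈ W := fun x hx => (hKT x hx).2
  have hψm : ∀ x ∈ K, x ≠ y → ψ x ≠ m := by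
    intro x hx hxy h
    refine hxy ?_
    rw [← hIs x hx.1]
    change _ = I (e m)
    rw [← h]
    change _ = I (e (e.symm (I.symm x)))
    rw [e.right_inv (hKT x hx).1]
  obtain ⟨t, ht, ht'⟩ := hasRootOn_halfBox_diff_singleton (G := G ∘ ψ) hr (hI0 (e m))
    (hG.comp (hψ.mono sdiff_subset) fun x hx => hψW x hx.1)
    (fun x hx => hG1 _ (hψW x hx.1) (hψm x hx.1 hx.2))
  refine ⟨e.source ∩ (fun x => I (e x)) ⁻¹' {x | ∀ i, |x i - y i| < r}, ?_, ?_, ?_, t ∘ (fun x => I (e x)), ?_, ?_⟩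
  · rintro x ⟨hx, hx'⟩
    have := hψW (I (e x)) ⟨hI0 _, hx'⟩
    simp only [ψ] at this
    rwa [I.left_inv, e.left_inv hx] at this
  · refine (I.continuous.comp_continuousOn e.continuousOn).isOpen_inter_preimage e.open_source ?_
    simp only [ofPred_forall]
    exact isOpen_iInter_of_finite fun i => isOpen_lt (by fun_prop) continuous_const
  · exact ⟨hme, fun i => by simpa [y] using hr⟩
  · refine ht.comp ((I.continuous.comp_continuousOn e.continuousOn).mono fun x hx => hx.1.1) ?_
    rintro x ⟨⟨hx, hx'⟩, hxm⟩
    exact ⟨⟨hI0 _, hx'⟩, fun h => hxm (e.injOn hx hme (I.injective h))⟩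
  · rintro x ⟨⟨hx, hx'⟩, hxm⟩
    have h3 := ht' (I (e x)) ⟨⟨hI0 _, hx'⟩, fun h => hxm (e.injOn hx hme (I.injective h))⟩
    simp only [ψ, Function.comp] at h3
    rwa [I.left_inv, e.left_inv hx] at h3

/-! ### Points of the tetrahedron and gluings -/

theorem mem_supp {x : Tet} {k : Fin 4} : k ∈ supp x ↔ x.1 k ≠ 0 := by simp [supp]

theorem supp_nonempty (x : Tet) : (supp x).Nonempty := by
  by_contra h
  rw [Finset.not_nonempty_iff_eq_empty] at h
  have h1 : ∀ k, x.1 k = 0 := fun k => by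
    by_contra hk
    have : k ∈ supp x := mem_supp.2 hk
    simp [h] at this
  have := x.2.2
  simp [h1] at this

/-- The affine automorphism of the tetrahedron that permutes the vertices by `σ`. -/
def permTet (σ : Equiv.Perm (Fin 4)) (x : Tet) : Tet :=
  ⟨fun k => x.1 (σ.symm k), fun _ => x.2.1 _, (Equiv.sum_comp σ.symm x.1).trans x.2.2⟩

@[simp]
theorem permTet_apply (σ : Equiv.Perm (Fin 4)) (x : Tet) (k : Fin 4) :
    (permTet σ x).1 (σ k) = x.1 k := by simp [permTet]

theorem permTet_mul (σ π : Equiv.Perm (Fin 4)) (x : Tet) :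
    permTet (σ * π) x = permTet σ (permTet π x) := rfl

theorem permTet_inv_permTet (σ : Equiv.Perm (Fin 4)) (x : Tet) :
    permTet σ⁻¹ (permTet σ x) = x := by
  rw [← permTet_mul, inv_mul_cancel]; rfl

theorem eq_permTet_iff {σ : Equiv.Perm (Fin 4)} {x y : Tet} :
    y = permTet σ x ↔ ∀ k, y.1 (σ k) = x.1 k := by
  constructor
  · rintro rfl k; simp
  · intro h
    apply Subtype.ext
    funext k
    have := h (σ.symm k)
    simpa [permTet] using this

theorem continuous_permTet (σ : Equiv.Perm (Fin 4)) : Continuous (permTet σ) :=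
  continuous_induced_rng.2
    (continuous_pi fun k => (continuous_apply (σ.symm k)).comp continuous_subtype_val)

theorem supp_permTet (σ : Equiv.Perm (Fin 4)) (x : Tet) :
    supp (permTet σ x) = (supp x).image σ := by
  ext k
  obtain ⟨k, rfl⟩ := σ.surjective k
  simp [mem_supp]

namespace Triangulation

variable {n : ℕ} (T : Triangulation n)

theorem glued_iff {T : Triangulation n} {i j : Fin n} {x y : Tet} :
    T.Glued (i, x) (j, y) ↔ ∃ f σ, T.glue i f = some (j, σ) ∧ x.1 f = 0 ∧ y = permTet σ x := by
  simp only [Glued, eq_permTet_iff]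

theorem Glued.symm {T : Triangulation n} {p q : Fin n × Tet} (h : T.Glued p q) : T.Glued q p := by
  obtain ⟨i, x⟩ := p
  obtain ⟨j, y⟩ := q
  obtain ⟨f, σ, h1, h2, rfl⟩ := glued_iff.1 h
  exact glued_iff.2 ⟨σ f, σ⁻¹, T.glue_symm _ _ _ _ h1, by simpa using h2, (permTet_inv_permTet _ _).symm⟩

theorem EdgeGlued.symm {T : Triangulation n} {p q : Fin n × Finset (Fin 4)} (h : T.EdgeGlued p q) :
    T.EdgeGlued q p := by
  obtain ⟨f, σ, h1, h2, h3⟩ := h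
  refine ⟨σ f, σ⁻¹, T.glue_symm _ _ _ _ h1, by simpa [h3] using h2, ?_⟩
  rw [h3, Finset.image_image]
  simp

theorem incl_eq_iff {T : Triangulation n} {i j : Fin n} {x y : Tet} :
    T.incl i x = T.incl j y ↔ Relation.EqvGen T.Glued (i, x) (j, y) := Quot.eq

theorem incl_eq_of_glue {T : Triangulation n} {i j : Fin n} {f : Fin 4} {σ : Equiv.Perm (Fin 4)}
    (h : T.glue i f = some (j, σ)) {x : Tet} (hx : x.1 f = 0) :
    T.incl i x = T.incl j (permTet σ x) :=
  Quot.sound (glued_iff.2 ⟨f, σ, h, hx, rfl⟩)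

theorem continuous_incl (i : Fin n) : Continuous (T.incl i) :=
  continuous_quot_mk.comp (Continuous.prodMk_right i)

theorem exists_incl_eq (p : T.Space) : ∃ i x, T.incl i x = p := by
  obtain ⟨⟨i, x⟩, rfl⟩ := Quot.exists_rep p
  exact ⟨i, x, rfl⟩

/-- The number of vertices of the open simplex that contains a point. -/
def suppCard (p : T.Space) : ℕ :=
  Quot.lift (fun q : Fin n × Tet => (supp q.2).card) (by
    rintro ⟨i, x⟩ ⟨j, y⟩ h
    obtain ⟨f, σ, h1, h2, rfl⟩ := glued_iff.1 h
    simp only [supp_permTet]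
    exact (Finset.card_image_of_injective _ σ.injective).symm) p

@[simp]
theorem suppCard_incl (i : Fin n) (x : Tet) : T.suppCard (T.incl i x) = (supp x).card := rfl

end Triangulation

/-! ### Flags -/

/-- A tetrahedron with an ordering `a, b, c, d` of its vertices, viewed as the oriented edge `ab`
in the face `abc`. -/
abbrev Flag (n : ℕ) : Type := Fin n × Equiv.Perm (Fin 4)

namespace Flag

variable {n : ℕ}

/-- Reverse the oriented edge. -/
def rev (q : Flag n) : Flag n := (q.1, q.2 * Equiv.swap 0 1)

/-- Move to the other face at the edge. -/
def rot (q : Flag n) : Flag n := (q.1, q.2 * Equiv.swap 2 3)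

@[simp] theorem rev_rev (q : Flag n) : q.rev.rev = q := by simp [rev, mul_assoc]
@[simp] theorem rot_rot (q : Flag n) : q.rot.rot = q := by simp [rot, mul_assoc]
theorem rot_rev (q : Flag n) : q.rev.rot = q.rot.rev := by
  have : (Equiv.swap 0 1 * Equiv.swap 2 3 : Equiv.Perm (Fin 4)) = Equiv.swap 2 3 * Equiv.swap 0 1 := by
    decide
  simp [rev, rot, mul_assoc, this]
theorem rev_zero (q : Flag n) : q.rev.2 0 = q.2 1 := by simp [rev]
theorem rev_one (q : Flag n) : q.rev.2 1 = q.2 0 := by simp [rev]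
theorem rev_two (q : Flag n) : q.rev.2 2 = q.2 2 := by
  rw [rev, Equiv.Perm.mul_apply, Equiv.swap_apply_of_ne_of_ne (by decide) (by decide)]
theorem rev_three (q : Flag n) : q.rev.2 3 = q.2 3 := by
  rw [rev, Equiv.Perm.mul_apply, Equiv.swap_apply_of_ne_of_ne (by decide) (by decide)]
theorem rot_zero (q : Flag n) : q.rot.2 0 = q.2 0 := by
  rw [rot, Equiv.Perm.mul_apply, Equiv.swap_apply_of_ne_of_ne (by decide) (by decide)]
theorem rot_one (q : Flag n) : q.rot.2 1 = q.2 1 := by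
  rw [rot, Equiv.Perm.mul_apply, Equiv.swap_apply_of_ne_of_ne (by decide) (by decide)]
theorem rot_two (q : Flag n) : q.rot.2 2 = q.2 3 := by simp [rot]
theorem rot_three (q : Flag n) : q.rot.2 3 = q.2 2 := by simp [rot]

theorem rev_ne (q : Flag n) : q.rev ≠ q := by
  intro h
  have h1 : q.rev.2 0 = q.2 0 := by rw [h]
  rw [rev_zero] at h1
  exact absurd (q.2.injective h1) (by decide)

theorem rev_ne_rot (q : Flag n) : q.rev ≠ q.rot := by
  intro h
  have h1 : q.rev.2 0 = q.rot.2 0 := by rw [h]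
  rw [rev_zero, rot_zero] at h1
  exact absurd (q.2.injective h1) (by decide)

end Flag

namespace Triangulation

variable {n : ℕ} (T : Triangulation n)

/-- The flag on the other side of the face of a flag. -/
def flip (q : Flag n) : Option (Flag n) := (T.glue q.1 (q.2 3)).map fun p => (p.1, p.2 * q.2)

variable {T}

theorem flip_eq_some {q q' : Flag n} :
    T.flip q = some q' ↔ ∃ σ, T.glue q.1 (q.2 3) = some (q'.1, σ) ∧ q'.2 = σ * q.2 := by
  rw [flip, Option.map_eq_some_iff]
  constructor
  · rintro ⟨⟨j, σ⟩, h, rfl⟩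
    exact ⟨σ, h, rfl⟩
  · rintro ⟨σ, h, h'⟩
    exact ⟨_, h, Prod.ext rfl h'.symm⟩

theorem flip_symm {q q' : Flag n} (h : T.flip q = some q') : T.flip q' = some q := by
  obtain ⟨σ, h1, h2⟩ := flip_eq_some.1 h
  refine flip_eq_some.2 ⟨σ⁻¹, ?_, by rw [h2, inv_mul_cancel_left]⟩
  rw [h2]
  exact T.glue_symm _ _ _ _ h1

theorem flip_rev {q q' : Flag n} (h : T.flip q = some q') : T.flip q.rev = some q'.rev := by
  obtain ⟨σ, h1, h2⟩ := flip_eq_some.1 h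
  refine flip_eq_some.2 ⟨σ, ?_, ?_⟩
  · rw [Flag.rev_three]; exact h1
  · simp [Flag.rev, h2, mul_assoc]

/-- Otherwise a face would be glued to itself, which `glue_ne` forbids. This is what keeps `faceVec`
from cancelling to zero. -/
theorem flip_rev_ne (q : Flag n) : T.flip q.rev ≠ some q := by
  intro h
  obtain ⟨σ, h1, h2⟩ := flip_eq_some.1 h
  refine T.glue_ne _ _ _ _ h1 (Prod.ext rfl ?_)
  change σ (q.rev.2 3) = q.rev.2 3
  rw [← Equiv.Perm.mul_apply, ← h2, Flag.rev_three]

variable (T) in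
/-- Two flags belong to the same oriented edge of the triangulation. -/
def FlagEquiv : Flag n → Flag n → Prop :=
  Relation.EqvGen fun q q' => q' = q.rot ∨ T.flip q = some q'

theorem flagEquiv_rot (q : Flag n) : T.FlagEquiv q q.rot := .rel _ _ (Or.inl rfl)

theorem flagEquiv_flip {q q' : Flag n} (h : T.flip q = some q') : T.FlagEquiv q q' :=
  .rel _ _ (Or.inr h)

/-- Gluing along a face containing the edge of a flag is compatible with equivalence of flags. -/
theorem flagEquiv_glue {i j : Fin n} {f : Fin 4} {σ π : Equiv.Perm (Fin 4)}
    (h : T.glue i f = some (j, σ)) (h0 : π 0 ≠ f) (h1 : π 1 ≠ f) :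
    T.FlagEquiv (i, π) (j, σ * π) := by
  obtain ⟨k, rfl⟩ := π.surjective f
  have hk : k = 2 ∨ k = 3 := by
    have h0' : k ≠ 0 := fun h => h0 (h ▸ rfl)
    have h1' : k ≠ 1 := fun h => h1 (h ▸ rfl)
    exact (by decide : ∀ k : Fin 4, k ≠ 0 → k ≠ 1 → k = 2 ∨ k = 3) k h0' h1'
  rcases hk with rfl | rfl
  -- `flip` crosses only the face opposite the last vertex; the other face at the edge is reached by
  -- rotating before and after.
  · refine (flagEquiv_rot _).trans _ _ _ (.trans _ (Flag.rot (j, σ * π)) _ (flagEquiv_flip ?_) ?_)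
    · refine flip_eq_some.2 ⟨σ, ?_, ?_⟩
      · rw [Flag.rot_three]; exact h
      · simp [Flag.rot, mul_assoc]
    · have := flagEquiv_rot (T := T) (Flag.rot (j, σ * π))
      rwa [Flag.rot_rot] at this
  · exact flagEquiv_flip (flip_eq_some.2 ⟨σ, h, rfl⟩)

end Triangulation

/-! ### An odd vector field near the midpoint of an edge -/

namespace Flag

variable {n : ℕ}

open Classical in
/-- An odd function of flags that depends only on the oriented edge of the tetrahedron. -/
def edgeVec (q : Flag n) (t : Flag n) : ℝ :=
  (if t = q ∨ t = q.rot then 1 else 0) - (if t = q.rev ∨ t = q.rev.rot then 1 else 0)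

theorem edgeVec_rot (q t : Flag n) : q.rot.edgeVec t = q.edgeVec t := by
  simp only [edgeVec, rot_rot, ← rot_rev q, or_comm (a := t = q.rot), or_comm (a := t = q.rev.rot)]

theorem edgeVec_rev (q t : Flag n) : q.rev.edgeVec t = - q.edgeVec t := by
  simp [edgeVec]

theorem edgeVec_self (q : Flag n) : q.edgeVec q = 1 := by
  have h1 : ¬ q = q.rev := fun h => rev_ne q h.symm
  have h2 : ¬ q = q.rev.rot := fun h => rev_ne_rot q (by rw [← rot_rot q.rev, ← h])
  simp [edgeVec, h1, h2]

/-- A function on the tetrahedron that is positive at the midpoint of the edge of the flag, and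
vanishes on all faces that do not contain the edge. -/
def cutoff (q : Flag n) (x : Tet) : ℝ := max 0 (min (x.1 (q.2 0)) (x.1 (q.2 1)) - 1 / 3)

theorem continuous_coord (k : Fin 4) : Continuous fun x : Tet => x.1 k :=
  (continuous_apply k).comp continuous_subtype_val

theorem continuous_cutoff (q : Flag n) : Continuous q.cutoff :=
  continuous_const.max (((continuous_coord _).min (continuous_coord _)).sub continuous_const)

theorem cutoff_nonneg (q : Flag n) (x : Tet) : 0 ≤ q.cutoff x := le_max_left _ _

theorem cutoff_pos {q : Flag n} {x : Tet} :
    0 < q.cutoff x ↔ 1 / 3 < x.1 (q.2 0) ∧ 1 / 3 < x.1 (q.2 1) := by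
  rw [cutoff, lt_max_iff, sub_pos, lt_min_iff]
  simp

theorem cutoff_rev (q : Flag n) (x : Tet) : q.rev.cutoff x = q.cutoff x := by
  rw [cutoff, rev_zero, rev_one, min_comm, cutoff]

theorem cutoff_rot (q : Flag n) (x : Tet) : q.rot.cutoff x = q.cutoff x := by
  rw [cutoff, rot_zero, rot_one, cutoff]

theorem cutoff_permTet (i j : Fin n) (σ π : Equiv.Perm (Fin 4)) (x : Tet) :
    cutoff (j, σ * π) (permTet σ x) = cutoff (i, π) x := by
  simp [cutoff]

theorem sum_coord (q : Flag n) (x : Tet) :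
    x.1 (q.2 0) + x.1 (q.2 1) + x.1 (q.2 2) + x.1 (q.2 3) = 1 := by
  rw [← x.2.2, ← Equiv.sum_comp q.2, Fin.sum_univ_four]

/-- Two flags of a tetrahedron with a positive cutoff at the same point have the same edge. -/
theorem eq_of_cutoff_pos {i : Fin n} {π π' : Equiv.Perm (Fin 4)} {x : Tet}
    (h : 0 < cutoff (i, π) x) (h' : 0 < cutoff (i, π') x) :
    (i, π') = ((i, π) : Flag n) ∨ (i, π') = rev (i, π) ∨ (i, π') = rot (i, π) ∨
      (i, π') = (rev (i, π)).rot := by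
  obtain ⟨g, rfl⟩ : ∃ g, π' = π * g := ⟨π⁻¹ * π', by simp⟩
  obtain ⟨h0, h1⟩ := cutoff_pos.1 h
  obtain ⟨h0', h1'⟩ := cutoff_pos.1 h'
  -- Two coordinates above 1/3 leave less than 1/3 for the other two together, so the edge is
  -- determined by the point.
  have key : ∀ k, 1 / 3 < x.1 (π k) → k = 0 ∨ k = 1 := by
    intro k hk
    have hs := sum_coord (i, π) x
    have h2 := x.2.1 (π 2)
    have h3 := x.2.1 (π 3)
    simp only at hs h0 h1
    fin_cases k
    · left; rfl
    · right; rfl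
    · exfalso; simp only [Fin.reduceFinMk] at hk; linarith
    · exfalso; simp only [Fin.reduceFinMk] at hk; linarith
  have hg : ∀ g : Equiv.Perm (Fin 4), (g 0 = 0 ∨ g 0 = 1) → (g 1 = 0 ∨ g 1 = 1) →
      g = 1 ∨ g = Equiv.swap 0 1 ∨ g = Equiv.swap 2 3 ∨ g = Equiv.swap 0 1 * Equiv.swap 2 3 := by
    decide
  rcases hg g (key _ h0') (key _ h1') with rfl | rfl | rfl | rfl
  · left; rfl
  · right; left; rfl
  · right; right; left; rfl
  · right; right; right; simp [rev, rot, mul_assoc]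

end Flag

namespace Triangulation

variable {n : ℕ} (T : Triangulation n)

open Classical in
/-- An odd function of flags that is invariant under `flip`. -/
def faceVec (q : Flag n) (t : Flag n) : ℝ :=
  (if t = q ∨ T.flip q = some t then 1 else 0) - (if t = q.rev ∨ T.flip q.rev = some t then 1 else 0)

theorem faceVec_rev (q t : Flag n) : T.faceVec q.rev t = - T.faceVec q t := by
  simp [faceVec]

theorem faceVec_flip {q q' : Flag n} (h : T.flip q = some q') (t : Flag n) :
    T.faceVec q' t = T.faceVec q t := by
  simp only [faceVec, h, flip_symm h, flip_rev h, flip_symm (flip_rev h), Option.some_inj]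
  simp only [eq_comm, or_comm]

theorem faceVec_self (q : Flag n) : T.faceVec q q = 1 := by
  have h1 : ¬ q = q.rev := fun h => Flag.rev_ne q h.symm
  simp [faceVec, h1, flip_rev_ne]

/-- The index set of the coordinates of `oddField`. -/
abbrev FieldIndex (n : ℕ) : Type := Option (Flag n ⊕ Flag n)

/-- A vector field on a tetrahedron that is odd under reversal of the edge, compatible with
gluings, and vanishes only at the midpoint of the edge and outside the support of the cutoff. -/
def oddField (q : Flag n) (x : Tet) : FieldIndex n → ℝ
  | none => q.cutoff x * (x.1 (q.2 0) - x.1 (q.2 1))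
  | some (Sum.inl t) =>
      q.cutoff x * (x.1 (q.2 2) * T.faceVec q t + x.1 (q.2 3) * T.faceVec q.rot t)
  -- Inside the tetrahedron the two face terms may cancel, for instance if `T.flip q = some
  -- q.rev.rot`. This coordinate excludes that, and vanishes on both faces at the edge, so it
  -- imposes no condition on gluings.
  | some (Sum.inr t) => q.cutoff x * (min (x.1 (q.2 2)) (x.1 (q.2 3)) * q.edgeVec t)

theorem continuous_oddField (q : Flag n) : Continuous (T.oddField q) := by
  have hc := q.continuous_cutoff
  have hx := Flag.continuous_coord
  refine continuous_pi fun k => ?_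
  rcases k with _ | t | t
  · exact hc.mul ((hx _).sub (hx _))
  · exact hc.mul (((hx _).mul continuous_const).add ((hx _).mul continuous_const))
  · exact hc.mul (((hx _).min (hx _)).mul continuous_const)

theorem oddField_of_cutoff {q : Flag n} {x : Tet} (h : q.cutoff x = 0) : T.oddField q x = 0 := by
  funext k
  rcases k with _ | t | t <;> simp [oddField, h]

theorem oddField_rev (q : Flag n) (x : Tet) : T.oddField q.rev x = - T.oddField q x := by
  funext k
  rcases k with _ | t | t
  · simp only [oddField, Flag.cutoff_rev, Flag.rev_zero, Flag.rev_one, Pi.neg_apply]; ring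
  · simp only [oddField, Flag.cutoff_rev, Flag.rev_two, Flag.rev_three, Pi.neg_apply, Flag.rot_rev,
      faceVec_rev]; ring
  · simp only [oddField, Flag.cutoff_rev, Flag.rev_two, Flag.rev_three, Pi.neg_apply,
      Flag.edgeVec_rev]; ring

theorem oddField_rot (q : Flag n) (x : Tet) : T.oddField q.rot x = T.oddField q x := by
  funext k
  rcases k with _ | t | t
  · simp only [oddField, Flag.cutoff_rot, Flag.rot_zero, Flag.rot_one]
  · simp only [oddField, Flag.cutoff_rot, Flag.rot_two, Flag.rot_three, Flag.rot_rot]; ring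
  · simp only [oddField, Flag.cutoff_rot, Flag.rot_two, Flag.rot_three, Flag.edgeVec_rot, min_comm]

/-- On the glued face the minimum vanishes and only one face term survives; its vector is invariant
under `flip`. -/
theorem oddField_flip {i j : Fin n} {σ π : Equiv.Perm (Fin 4)} {x : Tet}
    (h : T.glue i (π 3) = some (j, σ)) (hx : x.1 (π 3) = 0) :
    T.oddField (j, σ * π) (permTet σ x) = T.oddField (i, π) x := by
  have hf : T.flip (i, π) = some (j, σ * π) := flip_eq_some.2 ⟨σ, h, rfl⟩
  have h2 := x.2.1 (π 2)
  funext k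
  rcases k with _ | t | t
  · simp only [oddField, Flag.cutoff_permTet i j, Equiv.Perm.mul_apply, permTet_apply]
  · simp only [oddField, Flag.cutoff_permTet i j, Equiv.Perm.mul_apply, permTet_apply, hx,
      T.faceVec_flip hf, zero_mul]
  · simp only [oddField, Flag.cutoff_permTet i j, Equiv.Perm.mul_apply, permTet_apply, hx,
      min_eq_right h2, zero_mul]

theorem oddField_glue {i j : Fin n} {f : Fin 4} {σ π : Equiv.Perm (Fin 4)} {x : Tet}
    (h : T.glue i f = some (j, σ)) (h0 : π 0 ≠ f) (h1 : π 1 ≠ f) (hx : x.1 f = 0) :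
    T.oddField (j, σ * π) (permTet σ x) = T.oddField (i, π) x := by
  obtain ⟨k, rfl⟩ := π.surjective f
  have hk : k = 2 ∨ k = 3 := by
    have h0' : k ≠ 0 := fun h => h0 (h ▸ rfl)
    have h1' : k ≠ 1 := fun h => h1 (h ▸ rfl)
    exact (by decide : ∀ k : Fin 4, k ≠ 0 → k ≠ 1 → k = 2 ∨ k = 3) k h0' h1'
  rcases hk with rfl | rfl
  · rw [← T.oddField_rot (i, π), ← T.oddField_rot (j, σ * π)]
    have := T.oddField_flip (i := i) (j := j) (σ := σ) (π := π * Equiv.swap 2 3) (x := x)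
      (by simpa using h) (by simpa using hx)
    rw [← mul_assoc] at this
    exact this
  · exact T.oddField_flip h hx

/-- Away from the midpoint of the edge, `oddField` does not vanish where the cutoff is positive. -/
theorem eq_of_oddField_eq_zero {q : Flag n} {x : Tet} (hc : 0 < q.cutoff x) (h : T.oddField q x = 0) :
    x.1 (q.2 0) = 1 / 2 ∧ x.1 (q.2 1) = 1 / 2 ∧ x.1 (q.2 2) = 0 ∧ x.1 (q.2 3) = 0 := by
  have e1 := congrFun h none
  have e2 := congrFun h (some (Sum.inr q))
  have e3 := congrFun h (some (Sum.inl q))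
  have e4 := congrFun h (some (Sum.inl q.rot))
  simp only [oddField, Pi.zero_apply, mul_eq_zero, hc.ne', false_or, Flag.edgeVec_self, mul_one,
    faceVec_self] at e1 e2 e3 e4
  have hs := q.sum_coord x
  have h2 := x.2.1 (q.2 2)
  have h3 := x.2.1 (q.2 3)
  -- The edge coordinate forces the smaller of the two coordinates to vanish; one face term is then
  -- left, with coefficient 1 at its own flag.
  have : x.1 (q.2 2) = 0 ∧ x.1 (q.2 3) = 0 := by
    rcases min_choice (x.1 (q.2 2)) (x.1 (q.2 3)) with hm | hm
    · rw [hm] at e2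
      simp [e2] at e4
      exact ⟨e2, e4⟩
    · rw [hm] at e2
      simp [e2] at e3
      exact ⟨e3, e2⟩
  refine ⟨by linarith, by linarith, this.1, this.2⟩

end Triangulation

/-! ### Edges of a triangulated 3-manifold are not glued to themselves in reverse -/

namespace Triangulation

variable {n : ℕ} (T : Triangulation n)

open Classical in
/-- The sum of `h` over the flags of a tetrahedron that are equivalent to `q₀`. -/
def flagSum {V : Type*} [AddCommMonoid V] (q₀ : Flag n) (h : Flag n → Tet → V) (p : Fin n × Tet) : V :=
  ∑ π, if T.FlagEquiv q₀ (p.1, π) then h (p.1, π) p.2 else 0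

variable {T} in
theorem flagEquiv_glue_iff {q₀ : Flag n} {i j : Fin n} {f : Fin 4} {σ π : Equiv.Perm (Fin 4)}
    (h : T.glue i f = some (j, σ)) (h0 : π 0 ≠ f) (h1 : π 1 ≠ f) :
    T.FlagEquiv q₀ (j, σ * π) ↔ T.FlagEquiv q₀ (i, π) := by
  have := flagEquiv_glue h h0 h1
  exact ⟨fun h => h.trans _ _ _ (this.symm _ _), fun h => h.trans _ _ _ this⟩

/-- The gluing permutation matches the flags of the two tetrahedra. Flags whose edge is not in the
glued face have zero cutoff at the point; for the others the gluing preserves both the equivalence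
class and the summand. -/
theorem flagSum_glued {V : Type*} [AddCommMonoid V] (q₀ : Flag n) {h : Flag n → Tet → V}
    (h0 : ∀ q x, q.cutoff x = 0 → h q x = 0)
    (hglue : ∀ i j f σ π x, T.glue i f = some (j, σ) → π 0 ≠ f → π 1 ≠ f → x.1 f = 0 →
      h (j, σ * π) (permTet σ x) = h (i, π) x) {p q : Fin n × Tet} (hpq : T.Glued p q) :
    T.flagSum q₀ h p = T.flagSum q₀ h q := by
  obtain ⟨i, x⟩ := p
  obtain ⟨j, y⟩ := q
  obtain ⟨f, σ, h1, h2, rfl⟩ := glued_iff.1 hpq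
  refine Fintype.sum_equiv (Equiv.mulLeft σ) _ _ fun π => ?_
  classical
  change (if T.FlagEquiv q₀ (i, π) then h (i, π) x else 0) =
    if T.FlagEquiv q₀ (j, σ * π) then h (j, σ * π) (permTet σ x) else 0
  by_cases hc : Flag.cutoff (i, π) x = 0
  · rw [h0 _ _ hc, h0 (j, σ * π) _ (by rw [Flag.cutoff_permTet i]; exact hc)]
    rw [ite_self, ite_self]
  · have hc' := Flag.cutoff_pos.1 ((Flag.cutoff_nonneg _ _).lt_of_ne' hc)
    have hπ0 : π 0 ≠ f := fun h => by rw [h, h2] at hc'; linarith [hc'.1]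
    have hπ1 : π 1 ≠ f := fun h => by rw [h, h2] at hc'; linarith [hc'.2]
    simp only [hglue _ _ _ _ _ _ h1 hπ0 hπ1 h2, flagEquiv_glue_iff h1 hπ0 hπ1]

theorem continuous_flagSum {V : Type*} [AddCommMonoid V] [TopologicalSpace V] [ContinuousAdd V]
    (q₀ : Flag n) {h : Flag n → Tet → V} (hc : ∀ q, Continuous (h q)) :
    Continuous (T.flagSum q₀ h) := by
  refine continuous_prod_of_discrete_left.2 fun i => ?_
  unfold flagSum
  refine continuous_finsetSum _ fun π _ => ?_
  by_cases hq : T.FlagEquiv q₀ (i, π)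
  · simpa only [hq, if_true] using hc _
  · simpa only [hq, if_false] using continuous_const

/-- The sum of the cutoffs of the flags equivalent to `q₀`, on the underlying space. -/
def cutoffSum (q₀ : Flag n) : T.Space → ℝ :=
  Quot.lift (T.flagSum q₀ Flag.cutoff) fun _ _ => T.flagSum_glued q₀ (fun _ _ h => h)
    fun i j _ σ π x _ _ _ _ => Flag.cutoff_permTet i j σ π x

/-- The sum of the squares of the fields of the flags equivalent to `q₀`, on the underlying space. -/
def squareSum (q₀ : Flag n) : T.Space → FieldIndex n → FieldIndex n → ℝ :=
  Quot.lift (T.flagSum q₀ fun q x => outer (T.oddField q x)) fun _ _ => T.flagSum_glued q₀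
    (fun q x h => by rw [T.oddField_of_cutoff h]; funext; simp [outer])
    fun i j f σ π x h h0 h1 hx => by rw [T.oddField_glue h h0 h1 hx]

theorem continuous_cutoffSum (q₀ : Flag n) : Continuous (T.cutoffSum q₀) :=
  continuous_quot_lift _ (T.continuous_flagSum q₀ fun q => q.continuous_cutoff)

theorem continuous_outer {ι : Type*} : Continuous (outer : (ι → ℝ) → _) :=
  continuous_pi fun i => continuous_pi fun j => (continuous_apply i).mul (continuous_apply j)

theorem continuous_squareSum (q₀ : Flag n) : Continuous (T.squareSum q₀) :=
  continuous_quot_lift _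
    (T.continuous_flagSum q₀ fun q => continuous_outer.comp (T.continuous_oddField q))

theorem cutoffSum_incl (q₀ : Flag n) (i : Fin n) (x : Tet) :
    T.cutoffSum q₀ (T.incl i x) = T.flagSum q₀ Flag.cutoff (i, x) := rfl

theorem squareSum_incl (q₀ : Flag n) (i : Fin n) (x : Tet) :
    T.squareSum q₀ (T.incl i x) = T.flagSum q₀ (fun q x => outer (T.oddField q x)) (i, x) := rfl

variable {T}

theorem cutoffSum_pos {q₀ q : Flag n} (h : T.FlagEquiv q₀ q) {x : Tet} (hx : 0 < q.cutoff x) :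
    0 < T.cutoffSum q₀ (T.incl q.1 x) := by
  rw [cutoffSum_incl]
  refine Finset.sum_pos' (fun π _ => ?_) ⟨q.2, Finset.mem_univ _, ?_⟩
  · split_ifs
    · exact Flag.cutoff_nonneg _ _
    · exact le_rfl
  · rwa [if_pos h]

theorem exists_cutoff_pos {q₀ : Flag n} {i : Fin n} {x : Tet} (h : 0 < T.cutoffSum q₀ (T.incl i x)) :
    ∃ π, T.FlagEquiv q₀ (i, π) ∧ 0 < Flag.cutoff (i, π) x := by
  by_contra! hne
  rw [cutoffSum_incl, flagSum] at h
  refine h.not_ge (Finset.sum_nonpos fun π _ => ?_)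
  dsimp only
  split_ifs with hq
  · exact hne π hq
  · exact le_rfl

/-- Both flags have the same edge, so the fields differ at most by the sign of a reversal, which the
square forgets. -/
theorem outer_oddField_eq {i : Fin n} {π π' : Equiv.Perm (Fin 4)} {x : Tet}
    (h : 0 < Flag.cutoff (i, π) x) (h' : 0 < Flag.cutoff (i, π') x) :
    outer (T.oddField (i, π') x) = outer (T.oddField (i, π) x) := by
  rcases Flag.eq_of_cutoff_pos h h' with h | h | h | h <;> rw [h]
  · rw [oddField_rev, outer_neg]
  · rw [oddField_rot]
  · rw [oddField_rot, oddField_rev, outer_neg]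

/-- All summands with positive cutoff are the same matrix, so a² is the number of those summands. -/
theorem exists_squareSum_eq {q₀ q : Flag n} (hq : T.FlagEquiv q₀ q) {x : Tet} (hx : 0 < q.cutoff x) :
    ∃ a : ℝ, 0 < a ∧ T.squareSum q₀ (T.incl q.1 x) = outer (a • T.oddField q x) := by
  classical
  let b : Equiv.Perm (Fin 4) → ℝ := fun π =>
    if T.FlagEquiv q₀ (q.1, π) ∧ 0 < Flag.cutoff (q.1, π) x then 1 else 0
  have hb : ∀ π, 0 ≤ b π := fun π => by simp only [b]; split_ifs <;> norm_num
  have hs : 0 < ∑ π, b π := Finset.sum_pos' (fun π _ => hb π) ⟨q.2, Finset.mem_univ _, by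
    simp only [b]; rw [if_pos ⟨hq, hx⟩]; norm_num⟩
  refine ⟨√(∑ π, b π), Real.sqrt_pos.2 hs, ?_⟩
  have h1 : outer (√(∑ π, b π) • T.oddField q x) = (∑ π, b π) • outer (T.oddField q x) := by
    funext k l
    simp only [outer, Pi.smul_apply, smul_eq_mul]
    rw [mul_mul_mul_comm, Real.mul_self_sqrt hs.le]
  rw [h1, squareSum_incl, flagSum, Finset.sum_smul]
  refine Finset.sum_congr rfl fun π _ => ?_
  simp only [b]
  by_cases hπ : T.FlagEquiv q₀ (q.1, π)
  · by_cases hc : 0 < Flag.cutoff (q.1, π) x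
    · rw [if_pos hπ, if_pos ⟨hπ, hc⟩, one_smul, outer_oddField_eq hx hc]
    · have hc' : Flag.cutoff (q.1, π) x = 0 := le_antisymm (not_lt.1 hc) (Flag.cutoff_nonneg _ _)
      rw [if_pos hπ, if_neg (fun h => hc h.2), zero_smul, T.oddField_of_cutoff hc']
      funext; simp [outer]
  · rw [if_neg hπ, if_neg (fun h => hπ h.1), zero_smul]

end Triangulation

/-! ### Small arcs around the midpoint of an edge -/

/-- The points of a small arc around the midpoint of the edge `01` of the tetrahedron. -/
def arcPoint (δ t : unitInterval) : Tet :=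
  ⟨![(1 - δ) / 2, (1 - δ) / 2, δ * t, δ * (1 - t)], by
    have h1 : 0 ≤ 1 - (δ : ℝ) := sub_nonneg.2 δ.2.2
    have h2 : 0 ≤ 1 - (t : ℝ) := sub_nonneg.2 t.2.2
    have h3 := δ.2.1
    have h4 := t.2.1
    refine ⟨fun k => ?_, ?_⟩
    · fin_cases k <;> simp <;> positivity
    · simp [Fin.sum_univ_four]; ring⟩

theorem continuous_arcPoint : Continuous fun p : unitInterval × unitInterval => arcPoint p.1 p.2 := by
  refine continuous_induced_rng.2 (continuous_pi fun k => ?_)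
  fin_cases k <;> simp [arcPoint] <;> fun_prop

theorem arcPoint_zero (t : unitInterval) : arcPoint 0 t = arcPoint 0 0 := by
  apply Subtype.ext
  simp [arcPoint]

theorem permTet_swap_arcPoint (δ t : unitInterval) : permTet (Equiv.swap 0 1) (arcPoint δ t) = arcPoint δ t := by
  symm
  rw [eq_permTet_iff]
  intro k
  fin_cases k
  · simp [arcPoint]
  · simp [arcPoint]
  · rw [Equiv.swap_apply_of_ne_of_ne (by decide) (by decide)]
  · rw [Equiv.swap_apply_of_ne_of_ne (by decide) (by decide)]

theorem permTet_swap_arcPoint' (δ t : unitInterval) :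
    permTet (Equiv.swap 2 3) (arcPoint δ t) = arcPoint δ (unitInterval.symm t) := by
  symm
  rw [eq_permTet_iff]
  intro k
  fin_cases k
  · rw [Equiv.swap_apply_of_ne_of_ne (by decide) (by decide)]; rfl
  · rw [Equiv.swap_apply_of_ne_of_ne (by decide) (by decide)]; rfl
  · simp [arcPoint]
  · simp [arcPoint]

namespace Flag

variable {n : ℕ}

/-- The points of a small arc around the midpoint of the edge of a flag. -/
def arc (q : Flag n) (δ t : unitInterval) : Tet := permTet q.2 (arcPoint δ t)

theorem continuous_arc (q : Flag n) : Continuous fun p : unitInterval × unitInterval => q.arc p.1 p.2 :=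
  (continuous_permTet q.2).comp continuous_arcPoint

theorem arc_rev (q : Flag n) (δ t : unitInterval) : q.rev.arc δ t = q.arc δ t := by
  simp only [arc, rev, permTet_mul, permTet_swap_arcPoint]

theorem arc_rot (q : Flag n) (δ t : unitInterval) : q.rot.arc δ t = q.arc δ (unitInterval.symm t) := by
  simp only [arc, rot, permTet_mul, permTet_swap_arcPoint']

theorem arc_zero (q : Flag n) (t : unitInterval) : q.arc 0 t = q.arc 0 0 := by
  simp only [arc, arcPoint_zero]

theorem cutoff_arc_pos (q : Flag n) {δ : unitInterval} (hδ : (δ : ℝ) < 1 / 3) (t : unitInterval) :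
    0 < q.cutoff (q.arc δ t) := by
  rw [cutoff_pos]
  simp only [arc, permTet_apply]
  constructor <;> simp [arcPoint] <;> linarith

theorem supp_card_arc_zero (q : Flag n) : (supp (q.arc 0 0)).card = 2 := by
  rw [arc, supp_permTet, Finset.card_image_of_injective _ q.2.injective]
  have : supp (arcPoint 0 0) = {0, 1} := by
    ext k
    rw [mem_supp]
    fin_cases k <;> simp [arcPoint]
  rw [this]
  rfl

theorem arc_ne (q : Flag n) {δ : unitInterval} (hδ : 0 < δ) (t : unitInterval) :
    (q.arc δ t).1 (q.2 2) ≠ 0 ∨ (q.arc δ t).1 (q.2 3) ≠ 0 := by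
  simp only [arc, permTet_apply]
  by_contra! h
  have hδ' : (δ : ℝ) ≠ 0 := ne_of_gt (show (0 : ℝ) < δ from hδ)
  have h1 : (δ : ℝ) * t = 0 := h.1
  have h2 : (δ : ℝ) * (1 - t) = 0 := h.2
  exact hδ' (by linarith)

theorem eq_arc_zero {q : Flag n} {x : Tet}
    (h : x.1 (q.2 0) = 1 / 2 ∧ x.1 (q.2 1) = 1 / 2 ∧ x.1 (q.2 2) = 0 ∧ x.1 (q.2 3) = 0) :
    x = q.arc 0 0 := by
  refine eq_permTet_iff.2 fun k => ?_
  fin_cases k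
  · simpa [arcPoint] using h.1
  · simpa [arcPoint] using h.2.1
  · simpa [arcPoint] using h.2.2.1
  · simpa [arcPoint] using h.2.2.2

end Flag

namespace Triangulation

variable {n : ℕ} {T : Triangulation n}

theorem incl_arc_flip {q q' : Flag n} (h : T.flip q = some q') (δ : unitInterval) :
    T.incl q.1 (q.arc δ 1) = T.incl q'.1 (q'.arc δ 1) := by
  obtain ⟨σ, h1, h2⟩ := flip_eq_some.1 h
  rw [Flag.arc, Flag.arc, h2, permTet_mul]
  refine incl_eq_of_glue h1 ?_
  simp [arcPoint]

theorem incl_arc_zero {q q' : Flag n} (h : T.FlagEquiv q q') :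
    T.incl q.1 (q.arc 0 0) = T.incl q'.1 (q'.arc 0 0) := by
  induction h with
  | rel q q' h =>
    rcases h with rfl | h
    · rw [Flag.arc_rot, Flag.arc_zero q (unitInterval.symm 0)]; rfl
    · rw [← Flag.arc_zero q 1, ← Flag.arc_zero q' 1]
      exact incl_arc_flip h 0
  | refl => rfl
  | symm _ _ _ ih => exact ih.symm
  | trans _ _ _ _ _ ih1 ih2 => exact ih1.trans ih2

theorem oddField_arc_flip {q q' : Flag n} (h : T.flip q = some q') (δ : unitInterval) :
    T.oddField q' (q'.arc δ 1) = T.oddField q (q.arc δ 1) := by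
  obtain ⟨i, π⟩ := q
  obtain ⟨j, π'⟩ := q'
  obtain ⟨σ, h1, h2⟩ := flip_eq_some.1 h
  simp only at h1 h2
  subst h2
  rw [Flag.arc, Flag.arc, permTet_mul]
  exact T.oddField_flip h1 (by simp [arcPoint])

open Topology in
/-- In a triangulated 3-manifold, no edge is identified with itself in reverse. -/
theorem not_flagEquiv_rev (hT : Nonempty (ChartedSpace (EuclideanHalfSpace 3) T.Space)) (q₀ : Flag n) :
    ¬ T.FlagEquiv q₀ q₀.rev := by
  intro hrev
  obtain ⟨hT⟩ := hT
  let m : T.Space := T.incl q₀.1 (q₀.arc 0 0)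
  let W : Set T.Space := {p | 0 < T.cutoffSum q₀ p}
  have hW : IsOpen W := isOpen_lt continuous_const (T.continuous_cutoffSum q₀)
  have hm : m ∈ W := cutoffSum_pos (.refl _) (q₀.cutoff_arc_pos (by simp) 0)
  have hG1 : ∀ p ∈ W, p ≠ m → T.squareSum q₀ p ∈ rankOne (FieldIndex n) := by
    intro p hp hpm
    obtain ⟨i, x, rfl⟩ := T.exists_incl_eq p
    obtain ⟨π, hπ, hc⟩ := exists_cutoff_pos hp
    obtain ⟨a, ha, hG⟩ := exists_squareSum_eq hπ hc
    refine ⟨_, ?_, hG⟩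
    refine smul_ne_zero ha.ne' fun h0 => hpm ?_
    rw [Flag.eq_arc_zero (T.eq_of_oddField_eq_zero hc h0)]
    exact (incl_arc_zero hπ).symm
  obtain ⟨M, hMW, hM, hmM, r, hr, hr'⟩ := exists_hasRootOn_diff_singleton hW hm
    (T.continuous_squareSum q₀).continuousOn hG1
  -- As δ tends to 0 all the arcs shrink to m. The parameter interval is compact and there are
  -- finitely many flags, so one δ brings all arcs into M.
  obtain ⟨δ, hδ0, hδ, hδM⟩ : ∃ δ : unitInterval, 0 < δ ∧ (δ : ℝ) < 1 / 3 ∧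
      ∀ q, T.FlagEquiv q₀ q → ∀ t, T.incl q.1 (q.arc δ t) ∈ M := by
    have h1 : ∀ᶠ δ : unitInterval in 𝓝 0, ∀ q, T.FlagEquiv q₀ q → ∀ t, T.incl q.1 (q.arc δ t) ∈ M := by
      rw [Filter.eventually_all]
      intro q
      by_cases hq : T.FlagEquiv q₀ q
      · simp only [hq, true_imp_iff]
        have := isCompact_univ.eventually_forall_of_forall_eventually (x₀ := (0 : unitInterval))
          (K := (univ : Set unitInterval)) (P := fun δ t => T.incl q.1 (q.arc δ t) ∈ M) (by
            intro t _
            have hc : Continuous fun z : unitInterval × unitInterval => T.incl q.1 (q.arc z.1 z.2) :=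
              (T.continuous_incl q.1).comp q.continuous_arc
            refine hc.continuousAt.eventually (hM.mem_nhds ?_)
            simp only
            rw [Flag.arc_zero, ← incl_arc_zero hq]
            exact hmM)
        simpa using this
      · simp [hq]
    have h2 : ∀ᶠ δ : unitInterval in 𝓝 0, (δ : ℝ) < 1 / 3 :=
      (isOpen_lt continuous_subtype_val continuous_const).mem_nhds (by simp)
    have : (𝓝[>] (0 : unitInterval)).NeBot := nhdsGT_neBot_of_exists_gt ⟨1, zero_lt_one⟩
    obtain ⟨δ, ⟨h1, h2⟩, h3⟩ := (((h1.and h2).filter_mono nhdsWithin_le_nhds).and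
      (self_mem_nhdsWithin (s := Ioi (0 : unitInterval)))).exists
    exact ⟨δ, h3, h2, h1⟩
  -- The point m has two nonzero barycentric coordinates, a point of an arc with δ > 0 has at least
  -- three.
  have hmem : ∀ q, T.FlagEquiv q₀ q → ∀ t, T.incl q.1 (q.arc δ t) ∈ M \ {m} := by
    intro q hq t
    refine ⟨hδM q hq t, fun h => ?_⟩
    have h1 := congrArg T.suppCard (mem_singleton_iff.1 h)
    simp only [m, suppCard_incl, Flag.supp_card_arc_zero] at h1
    have hc := Flag.cutoff_pos.1 (q.cutoff_arc_pos hδ t)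
    obtain ⟨k, hk, hk'⟩ : ∃ k, (k = 2 ∨ k = 3) ∧ (q.arc δ t).1 (q.2 k) ≠ 0 := by
      rcases q.arc_ne hδ0 t with h | h
      · exact ⟨2, Or.inl rfl, h⟩
      · exact ⟨3, Or.inr rfl, h⟩
    have hsub : ({0, 1, k} : Finset (Fin 4)).image q.2 ⊆ supp (q.arc δ t) := by
      intro l hl
      simp only [Finset.mem_image, Finset.mem_insert, Finset.mem_singleton] at hl
      obtain ⟨l, rfl | rfl | rfl, rfl⟩ := hl <;> rw [mem_supp]
      · linarith [hc.1]
      · linarith [hc.2]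
      · exact hk'
    have h3 := Finset.card_le_card hsub
    rw [Finset.card_image_of_injective _ q.2.injective, h1] at h3
    rcases hk with rfl | rfl <;> exact absurd h3 (by decide)
  -- On the arc the root is ± a positive multiple of `oddField`, so φ is nonzero and its sign tells
  -- which.
  let φ : Flag n → unitInterval → ℝ := fun q t =>
    ∑ k, r (T.incl q.1 (q.arc δ t)) k * T.oddField q (q.arc δ t) k
  have hφc : ∀ q, T.FlagEquiv q₀ q → Continuous (φ q) := by
    intro q hq
    have ha : Continuous (q.arc δ) := q.continuous_arc.comp (Continuous.prodMk_right δ)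
    have h1 : Continuous fun t => r (T.incl q.1 (q.arc δ t)) :=
      hr.comp_continuous ((T.continuous_incl q.1).comp ha) (hmem q hq)
    have h2 : Continuous fun t => T.oddField q (q.arc δ t) := (T.continuous_oddField q).comp ha
    exact continuous_finsetSum _ fun k _ =>
      ((continuous_apply k).comp h1).mul ((continuous_apply k).comp h2)
  have hφ0 : ∀ q, T.FlagEquiv q₀ q → ∀ t, φ q t ≠ 0 := by
    intro q hq t
    have hc := q.cutoff_arc_pos hδ t
    obtain ⟨a, ha, hG⟩ := exists_squareSum_eq hq hc
    rw [hr' _ (hmem q hq t)] at hG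
    have hF : T.oddField q (q.arc δ t) ≠ 0 := by
      intro h0
      have := T.eq_of_oddField_eq_zero hc h0
      exact (q.arc_ne hδ0 t).elim (fun h => h this.2.2.1) fun h => h this.2.2.2
    have hpos : 0 < ∑ k, T.oddField q (q.arc δ t) k * T.oddField q (q.arc δ t) k := by
      obtain ⟨k, hk⟩ := Function.ne_iff.1 hF
      exact Finset.sum_pos' (fun k _ => mul_self_nonneg _) ⟨k, Finset.mem_univ _, mul_self_pos.2 hk⟩
    have hpos' := mul_pos ha hpos
    rw [Finset.mul_sum] at hpos'
    simp only [φ]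
    rcases outer_eq_iff.1 hG with h | h
    · rw [h]
      simpa only [Pi.smul_apply, smul_eq_mul, mul_assoc] using hpos'.ne'
    · rw [h]
      simpa only [Pi.neg_apply, Pi.smul_apply, smul_eq_mul, mul_assoc, neg_mul, Finset.sum_neg_distrib, neg_ne_zero]
        using hpos'.ne'
  have hφs : ∀ q, T.FlagEquiv q₀ q → ∀ s t, 0 < φ q s → 0 < φ q t := by
    intro q hq s t hs
    by_contra ht
    obtain ⟨u, hu⟩ := mem_range_of_exists_le_of_exists_ge (hφc q hq) ⟨t, not_lt.1 ht⟩ ⟨s, hs.le⟩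
    exact hφ0 q hq u hu
  have hφrev : ∀ q t, φ q.rev t = - φ q t := by
    intro q t
    simp only [φ, Flag.arc_rev, oddField_rev, Pi.neg_apply, mul_neg, Finset.sum_neg_distrib]
    rfl
  have hφrot : ∀ q t, φ q.rot t = φ q (unitInterval.symm t) := by
    intro q t
    simp only [φ, Flag.arc_rot, oddField_rot]
    rfl
  have hφflip : ∀ q q', T.flip q = some q' → φ q' 1 = φ q 1 := by
    intro q q' h
    simp only [φ, oddField_arc_flip h, incl_arc_flip h]
  -- The parameter t = 1 lies in the face of the flag, where `flip` preserves φ. A rotation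
  -- exchanges the ends of the arc, along which φ keeps its sign by the intermediate value theorem.
  have key : ∀ q q', T.FlagEquiv q q' → T.FlagEquiv q₀ q → (0 < φ q 1 ↔ 0 < φ q' 1) := by
    intro q q' h
    induction h with
    | rel q q' h =>
      intro hq
      rcases h with rfl | h
      · rw [hφrot]
        exact ⟨hφs q hq _ _, hφs q hq _ _⟩
      · rw [hφflip _ _ h]
    | refl => intro _; rfl
    | symm q q' h ih => exact fun hq => (ih (hq.trans _ _ _ (h.symm _ _))).symm
    | trans q q' q'' h h' ih1 ih2 => exact fun hq => (ih1 hq).trans (ih2 (hq.trans _ _ _ h))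
  have h1 := key _ _ hrev (.refl _)
  rw [hφrev] at h1
  have h2 := hφ0 q₀ (.refl _) 1
  rcases lt_or_gt_of_ne h2 with h | h
  · have := h1.2 (neg_pos.2 h); linarith
  · have := h1.1 h; linarith

end Triangulation

/-! ### Points and open simplices that are identified -/

namespace Triangulation

variable {n : ℕ} {T : Triangulation n}

/-- Used to bound equivalence classes from above: a set closed under one symmetric step is a union
of classes. -/
theorem mem_iff_of_eqvGen {α : Type*} {r : α → α → Prop} (hr : ∀ p q, r p q → r q p) {S : Set α}
    (hS : ∀ p ∈ S, ∀ q, r p q → q ∈ S) {p q : α} (h : Relation.EqvGen r p q) : p ∈ S ↔ q ∈ S := by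
  induction h with
  | rel p q h => exact ⟨fun hp => hS p hp q h, fun hq => hS q hq p (hr _ _ h)⟩
  | refl => rfl
  | symm _ _ _ ih => exact ih.symm
  | trans _ _ _ _ _ ih1 ih2 => exact ih1.trans ih2

theorem eq_of_incl_eq_of_card_two (hrev : ∀ q : Flag n, ¬ T.FlagEquiv q q.rev) {i : Fin n} {x y : Tet}
    (h : T.incl i x = T.incl i y) (hs : supp x = supp y) (hc : (supp x).card = 2) : x = y := by
  obtain ⟨π, hπ⟩ : ∃ π : Equiv.Perm (Fin 4), supp x = {π 0, π 1} := by
    have : ∀ s : Finset (Fin 4), s.card = 2 → ∃ π : Equiv.Perm (Fin 4), s = {π 0, π 1} := by decide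
    exact this _ hc
  set x₀ := permTet π⁻¹ x with hx₀
  have hx : x = permTet π x₀ := by
    rw [hx₀, ← permTet_mul, mul_inv_cancel]; rfl
  have hsupp : ∀ k, x₀.1 k ≠ 0 ↔ k = 0 ∨ k = 1 := by
    intro k
    have h1 : π k ∈ supp x ↔ x₀.1 k ≠ 0 := by rw [mem_supp, hx, permTet_apply]
    rw [← h1, hπ]
    simp
  -- The copies of x obtained by carrying its coordinates along equivalent flags; they include every
  -- point identified with x.
  let C : Set (Fin n × Tet) := {p | ∃ π', T.FlagEquiv (i, π) (p.1, π') ∧ p.2 = permTet π' x₀}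
  have hC : ∀ p ∈ C, ∀ q, T.Glued p q → q ∈ C := by
    rintro ⟨j, -⟩ ⟨π', hπ', rfl⟩ ⟨j', y⟩ hg
    obtain ⟨f, σ, h1, h2, rfl⟩ := glued_iff.1 hg
    refine ⟨σ * π', hπ'.trans _ _ _ (flagEquiv_glue h1 ?_ ?_), rfl⟩
    · rintro rfl; rw [permTet_apply] at h2; exact (hsupp 0).2 (Or.inl rfl) h2
    · rintro rfl; rw [permTet_apply] at h2; exact (hsupp 1).2 (Or.inr rfl) h2
  obtain ⟨π', hπ', hy⟩ := (mem_iff_of_eqvGen (fun _ _ => Glued.symm) hC (incl_eq_iff.1 h)).1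
    ⟨π, .refl _, hx⟩
  simp only at hπ' hy
  obtain ⟨g, rfl⟩ : ∃ g, π' = π * g := ⟨π⁻¹ * π', by simp⟩
  have key : ∀ k, (k = 0 ∨ k = 1) → g k = 0 ∨ g k = 1 := by
    intro k hk
    have h1 : π (g k) ∈ supp y := by
      rw [mem_supp, hy, ← Equiv.Perm.mul_apply, permTet_apply]
      exact (hsupp k).2 hk
    rw [← hs, hπ] at h1
    simpa using h1
  have hg : ∀ g : Equiv.Perm (Fin 4), (g 0 = 0 ∨ g 0 = 1) → (g 1 = 0 ∨ g 1 = 1) →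
      g = 1 ∨ g = Equiv.swap 0 1 ∨ g = Equiv.swap 2 3 ∨ g = Equiv.swap 0 1 * Equiv.swap 2 3 := by
    decide
  -- The permutations that preserve the edge are the identity, the two swaps and their product.
  -- Those that exchange the ends would reverse the edge; the swap of the other two vertices fixes
  -- x₀.
  rcases hg g (key 0 (Or.inl rfl)) (key 1 (Or.inr rfl)) with rfl | rfl | rfl | rfl
  · rw [hy, hx, mul_one]
  · exact absurd hπ' (hrev _)
  · rw [hy, permTet_mul, hx]
    congr 1
    refine eq_permTet_iff.2 fun k => ?_
    have h2 : x₀.1 2 = 0 := not_not.1 (mt (hsupp 2).1 (by decide))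
    have h3 : x₀.1 3 = 0 := not_not.1 (mt (hsupp 3).1 (by decide))
    fin_cases k
    · rw [Equiv.swap_apply_of_ne_of_ne (by decide) (by decide)]
    · rw [Equiv.swap_apply_of_ne_of_ne (by decide) (by decide)]
    · simp [h2, h3]
    · simp [h2, h3]
  · refine absurd (hπ'.trans _ _ _ (flagEquiv_rot _)) ?_
    have : Flag.rot (i, π * (Equiv.swap 0 1 * Equiv.swap 2 3)) = Flag.rev (i, π) := by
      simp [Flag.rot, Flag.rev, mul_assoc]
    rw [this]
    exact hrev _

/-- A point of an open face is identified with at most one other, its partner across the gluing. If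
the partner had the same support in the same tetrahedron, the face would be glued to itself. -/
theorem eq_of_incl_eq_of_card_three {i : Fin n} {x y : Tet}
    (h : T.incl i x = T.incl i y) (hs : supp x = supp y) (hc : (supp x).card = 3) : x = y := by
  obtain ⟨f, hf⟩ : ∃ f, supp x = {f}ᶜ := by
    have : ∀ s : Finset (Fin 4), s.card = 3 → ∃ f, s = {f}ᶜ := by decide
    exact this _ hc
  have hx : ∀ k, x.1 k = 0 ↔ k = f := by
    intro k
    rw [← not_iff_not, ← ne_eq, ← mem_supp, hf]; simp
  rcases hg : T.glue i f with _ | ⟨j, σ⟩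
  · have := (mem_iff_of_eqvGen (fun _ _ => Glued.symm) (S := {(i, x)}) (by
      rintro _ rfl ⟨j, z⟩ hz
      obtain ⟨f', σ, h1, h2, -⟩ := glued_iff.1 hz
      rw [(hx f').1 h2, hg] at h1
      cases h1) (incl_eq_iff.1 h)).1 rfl
    exact (Prod.ext_iff.1 (mem_singleton_iff.1 this)).2.symm
  · have := (mem_iff_of_eqvGen (fun _ _ => Glued.symm) (S := {(i, x), (j, permTet σ x)}) (by
      rintro _ (rfl | rfl) ⟨j', z⟩ hz
      · obtain ⟨f', σ', h1, h2, rfl⟩ := glued_iff.1 hz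
        rw [(hx f').1 h2, hg] at h1
        cases h1
        right; rfl
      · obtain ⟨f', σ', h1, h2, rfl⟩ := glued_iff.1 hz
        obtain ⟨f', rfl⟩ := σ.surjective f'
        rw [permTet_apply] at h2
        rw [(hx f').1 h2, T.glue_symm _ _ _ _ hg] at h1
        cases h1
        left
        rw [permTet_inv_permTet]) (incl_eq_iff.1 h)).1 (Or.inl rfl)
    rcases this with h' | h'
    · exact (Prod.ext_iff.1 h').2.symm
    · obtain ⟨h1, h2⟩ := Prod.ext_iff.1 h'
      simp only at h1 h2
      subst h1 h2
      exfalso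
      refine T.glue_ne _ _ _ _ hg (Prod.ext rfl ?_)
      by_contra hne
      have h3 : σ f ∈ supp x := by rw [hf]; simpa using hne
      rw [hs, mem_supp, permTet_apply] at h3
      exact h3 ((hx f).2 rfl)

theorem eq_of_incl_eq_of_card_four {i : Fin n} {x y : Tet}
    (h : T.incl i x = T.incl i y) (hc : (supp x).card = 4) : x = y := by
  have hf : supp x = Finset.univ := Finset.card_eq_iff_eq_univ _ |>.1 hc
  have := (mem_iff_of_eqvGen (fun _ _ => Glued.symm) (S := {(i, x)}) (by
      rintro _ rfl ⟨j, z⟩ hz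
      obtain ⟨f', σ, h1, h2, -⟩ := glued_iff.1 hz
      have : f' ∈ supp x := by simp [hf]
      exact absurd h2 (mem_supp.1 this)) (incl_eq_iff.1 h)).1 rfl
  exact (Prod.ext_iff.1 (mem_singleton_iff.1 this)).2.symm

/-- In the absence of reversed edges, each open simplex of dimension at least one of a tetrahedron
embeds into the underlying space. -/
theorem eq_of_incl_eq (hrev : ∀ q : Flag n, ¬ T.FlagEquiv q q.rev) {i : Fin n} {x y : Tet}
    (h : T.incl i x = T.incl i y) (hs : supp x = supp y) (hc : 2 ≤ (supp x).card) : x = y := by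
  have h4 : (supp x).card ≤ 4 := (Finset.card_le_univ _).trans_eq (by simp)
  obtain hc | hc | hc : (supp x).card = 2 ∨ (supp x).card = 3 ∨ (supp x).card = 4 := by omega
  · exact eq_of_incl_eq_of_card_two hrev h hs hc
  · exact eq_of_incl_eq_of_card_three h hs hc
  · exact eq_of_incl_eq_of_card_four h hc

/-- `EdgeGlued` makes sense for vertex sets of any size, so faces and whole tetrahedra are treated
together with edges here and below. -/
theorem edgeGlued_supp {i j : Fin n} {x y : Tet} (h : T.incl i x = T.incl j y) :
    Relation.EqvGen T.EdgeGlued (i, supp x) (j, supp y) := by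
  have : ∀ p q : Fin n × Tet, Relation.EqvGen T.Glued p q →
      Relation.EqvGen T.EdgeGlued (p.1, supp p.2) (q.1, supp q.2) := by
    intro p q h
    induction h with
    | rel p q h =>
      obtain ⟨i, x⟩ := p
      obtain ⟨j, y⟩ := q
      obtain ⟨f, σ, h1, h2, rfl⟩ := glued_iff.1 h
      exact .rel _ _ ⟨f, σ, h1, by simpa [mem_supp] using h2, supp_permTet _ _⟩
    | refl => exact .refl _
    | symm _ _ _ ih => exact ih.symm
    | trans _ _ _ _ _ ih1 ih2 => exact ih1.trans _ _ _ ih2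
  exact this _ _ (incl_eq_iff.1 h)

/-- A converse to `edgeGlued_supp`: each gluing maps one open simplex affinely onto the other, so
points can be carried along a chain of identifications. -/
theorem exists_incl_eq_of_eqvGen {p q : Fin n × Finset (Fin 4)} (h : Relation.EqvGen T.EdgeGlued p q) :
    (∀ x, supp x = p.2 → ∃ y, supp y = q.2 ∧ T.incl p.1 x = T.incl q.1 y) ∧
    (∀ y, supp y = q.2 → ∃ x, supp x = p.2 ∧ T.incl q.1 y = T.incl p.1 x) := by
  have key : ∀ p q : Fin n × Finset (Fin 4), T.EdgeGlued p q → ∀ x, supp x = p.2 →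
      ∃ y, supp y = q.2 ∧ T.incl p.1 x = T.incl q.1 y := by
    rintro ⟨i, s⟩ ⟨j, t⟩ ⟨f, σ, h1, h2, h3⟩ x rfl
    simp only at h1 h2 h3
    exact ⟨permTet σ x, by rw [supp_permTet, h3], incl_eq_of_glue h1 (by simpa [mem_supp] using h2)⟩
  induction h with
  | rel p q h => exact ⟨key _ _ h, key _ _ h.symm⟩
  | refl p => exact ⟨fun x hx => ⟨x, hx, rfl⟩, fun x hx => ⟨x, hx, rfl⟩⟩
  | symm _ _ _ ih => exact ih.symm
  | trans _ _ _ _ _ ih1 ih2 =>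
    constructor
    · intro x hx
      obtain ⟨y, hy, hxy⟩ := ih1.1 x hx
      obtain ⟨z, hz, hyz⟩ := ih2.1 y hy
      exact ⟨z, hz, hxy.trans hyz⟩
    · intro x hx
      obtain ⟨y, hy, hxy⟩ := ih2.2 x hx
      obtain ⟨z, hz, hyz⟩ := ih1.2 y hy
      exact ⟨z, hz, hxy.trans hyz⟩

/-! ### Degrees -/

variable (T)

theorem edgeDegree_pos (i : Fin n) (s : Finset (Fin 4)) : 0 < T.edgeDegree i s :=
  (Set.ncard_pos (Set.toFinite _)).2 ⟨(i, s), .refl _⟩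

theorem edgeDegree_univ (i : Fin n) : T.edgeDegree i Finset.univ = 1 := by
  rw [edgeDegree, ncard_eq_one]
  refine ⟨(i, Finset.univ), Set.ext fun q => ⟨fun h => ?_, ?_⟩⟩
  · refine (mem_iff_of_eqvGen (fun _ _ => EdgeGlued.symm) (S := {(i, Finset.univ)}) ?_ h).1 rfl
    rintro _ rfl q ⟨f, σ, -, h2, -⟩
    simp at h2
  · rintro rfl; exact .refl _

/-- A face is identified with nothing, or with its one partner, which differs from it by `glue_ne`.
The reciprocals are the side weights 1 and 1/2. -/
theorem edgeDegree_compl_singleton (i : Fin n) (f : Fin 4) :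
    T.edgeDegree i {f}ᶜ = if T.glue i f = none then 1 else 2 := by
  rcases hg : T.glue i f with _ | ⟨j, σ⟩
  · rw [if_pos rfl, edgeDegree, ncard_eq_one]
    refine ⟨(i, {f}ᶜ), Set.ext fun q => ⟨fun h => ?_, ?_⟩⟩
    · refine (mem_iff_of_eqvGen (fun _ _ => EdgeGlued.symm) (S := {(i, ({f}ᶜ : Finset (Fin 4)))}) ?_ h).1 rfl
      rintro _ rfl q ⟨f', σ, h1, h2, -⟩
      have : f' = f := by simpa using h2
      rw [this, hg] at h1
      cases h1
    · rintro rfl; exact .refl _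
  · have himg : ∀ (σ : Equiv.Perm (Fin 4)) (f : Fin 4), ({f}ᶜ : Finset (Fin 4)).image σ = {σ f}ᶜ := by
      intro σ f
      ext k
      obtain ⟨k, rfl⟩ := σ.surjective k
      simp
    rw [if_neg (by simp), edgeDegree, ncard_eq_two]
    refine ⟨(i, {f}ᶜ), (j, {σ f}ᶜ), ?_, Set.ext fun q => ⟨fun h => ?_, ?_⟩⟩
    · intro h
      refine T.glue_ne _ _ _ _ hg ?_
      simpa [eq_comm] using h
    · refine (mem_iff_of_eqvGen (fun _ _ => EdgeGlued.symm) (S := {(i, ({f}ᶜ : Finset (Fin 4))), (j, ({σ f}ᶜ : Finset (Fin 4)))}) ?_ h).1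
        (Or.inl rfl)
      rintro _ (rfl | rfl) ⟨j', s⟩ ⟨f', σ', h1, h2, h3⟩
      · have : f' = f := by simpa using h2
        subst this
        rw [hg] at h1
        cases h1
        right
        rw [himg] at h3
        exact Prod.ext rfl h3
      · have : f' = σ f := by simpa using h2
        subst this
        rw [T.glue_symm _ _ _ _ hg] at h1
        cases h1
        left
        rw [himg] at h3
        simpa using h3
    · rintro (rfl | rfl)
      · exact .refl _
      · exact .rel _ _ ⟨f, σ, hg, by simp, (himg σ f).symm⟩

end Triangulation

/-! ### Open simplices of the tetrahedron -/

/-- The point of the tetrahedron with the given barycentric coordinates. -/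
def toTet (w : Fin 4 → ℝ) : Tet :=
  open Classical in if h : w ∈ stdSimplex ℝ (Fin 4) then ⟨w, h⟩ else ⟨_, single_mem_stdSimplex ℝ 0⟩

theorem toTet_val {w : Fin 4 → ℝ} (h : w ∈ stdSimplex ℝ (Fin 4)) : (toTet w).1 = w := by
  simp [toTet, h]

theorem continuousOn_toTet : ContinuousOn toTet (stdSimplex ℝ (Fin 4)) := by
  rw [continuousOn_iff_continuous_domRestrict]
  refine continuous_induced_rng.2 ?_
  convert continuous_subtype_val (p := (· ∈ stdSimplex ℝ (Fin 4))) using 1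
  funext w
  exact toTet_val w.2

theorem sum_eq_one_of_supp_subset {x : Tet} {s : Finset (Fin 4)} (h : supp x ⊆ s) :
    ∑ k ∈ s, x.1 k = 1 := by
  rw [← x.2.2]
  refine Finset.sum_subset (Finset.subset_univ _) fun k _ hk => ?_
  by_contra h0
  exact hk (h (mem_supp.2 h0))

theorem tet_ext_of_supp_subset {x y : Tet} {s : Finset (Fin 4)} (hx : supp x ⊆ s) (hy : supp y ⊆ s)
    (h : ∀ k ∈ s, x.1 k = y.1 k) : x = y := by
  apply Subtype.ext
  funext k
  by_cases hk : k ∈ s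
  · exact h k hk
  · have h1 : x.1 k = 0 := by by_contra h0; exact hk (hx (mem_supp.2 h0))
    have h2 : y.1 k = 0 := by by_contra h0; exact hk (hy (mem_supp.2 h0))
    rw [h1, h2]

theorem eq_of_supp_subset_singleton {x y : Tet} {a : Fin 4} (hx : supp x ⊆ {a}) (hy : supp y ⊆ {a}) :
    x = y := by
  refine tet_ext_of_supp_subset hx hy fun k hk => ?_
  have h1 := sum_eq_one_of_supp_subset hx
  have h2 := sum_eq_one_of_supp_subset hy
  rw [Finset.sum_singleton] at h1 h2
  rw [Finset.mem_singleton.1 hk, h1, h2]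

theorem exists_supp_eq {s : Finset (Fin 4)} (hs : s.Nonempty) : ∃ x : Tet, supp x = s := by
  have hc : (0 : ℝ) < s.card := by exact_mod_cast hs.card_pos
  refine ⟨⟨fun k => if k ∈ s then (s.card : ℝ)⁻¹ else 0, fun k => ?_, ?_⟩, ?_⟩
  · dsimp only; split_ifs <;> positivity
  · rw [Finset.sum_ite_mem, Finset.univ_inter, Finset.sum_const, nsmul_eq_mul, mul_inv_cancel₀ hc.ne']
  · ext k
    rw [mem_supp]
    simp [hs.ne_empty]

theorem isPreconnected_setOf_supp_eq (s : Finset (Fin 4)) : IsPreconnected {x : Tet | supp x = s} := by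
  rw [← Topology.IsInducing.subtypeVal.isPreconnected_image]
  have : (Subtype.val '' {x : Tet | supp x = s}) =
      stdSimplex ℝ (Fin 4) ∩ {w | (∀ k ∈ s, 0 < w k) ∧ ∀ k, k ∉ s → w k = 0} := by
    ext w
    constructor
    · rintro ⟨x, rfl, rfl⟩
      refine ⟨x.2, fun k hk => (x.2.1 k).lt_of_ne' (mem_supp.1 hk), fun k hk => ?_⟩
      rw [mem_supp, not_not] at hk
      exact hk
    · rintro ⟨hw, h1, h2⟩
      refine ⟨⟨w, hw⟩, ?_, rfl⟩
      ext k
      rw [mem_supp]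
      by_cases hk : k ∈ s
      · simp [hk, (h1 k hk).ne']
      · simp [hk, h2 k hk]
  rw [this]
  refine ((convex_stdSimplex ℝ (Fin 4)).inter ?_).isPreconnected
  rintro w ⟨hw1, hw2⟩ w' ⟨hw1', hw2'⟩ a b ha hb hab
  constructor
  · intro k hk
    have h1 := hw1 k hk
    have h2 := hw1' k hk
    change 0 < a * w k + b * w' k
    rcases ha.eq_or_lt with rfl | ha
    · have : b = 1 := by linarith
      subst this; linarith
    · have := mul_pos ha h1
      have := mul_nonneg hb h2.le
      linarith
  · intro k hk
    change a * w k + b * w' k = 0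
    rw [hw2 k hk, hw2' k hk]; ring

theorem continuous_piSingle (a : Fin 4) : Continuous fun t : ℝ => (Pi.single a t : Fin 4 → ℝ) := by
  refine continuous_pi fun k => ?_
  simp only [Pi.single_apply]
  split_ifs
  · exact continuous_id
  · exact continuous_const

/-- The points of the edge `ab`. -/
def seg (a b : Fin 4) (t : ℝ) : Tet := toTet (Pi.single a (1 - t) + Pi.single b t)

theorem seg_mem {a b : Fin 4} {t : ℝ} (ht : t ∈ Icc (0 : ℝ) 1) :
    (Pi.single a (1 - t) + Pi.single b t : Fin 4 → ℝ) ∈ stdSimplex ℝ (Fin 4) := by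
  have h1 : 0 ≤ 1 - t := sub_nonneg.2 ht.2
  have h2 := ht.1
  refine ⟨fun k => ?_, ?_⟩
  · simp only [Pi.add_apply, Pi.single_apply]
    split_ifs <;> linarith
  · simp [Finset.sum_add_distrib]

theorem seg_val {a b : Fin 4} {t : ℝ} (ht : t ∈ Icc (0 : ℝ) 1) :
    (seg a b t).1 = Pi.single a (1 - t) + Pi.single b t := toTet_val (seg_mem ht)

theorem continuousOn_seg (a b : Fin 4) : ContinuousOn (seg a b) (Icc 0 1) := by
  refine continuousOn_toTet.comp (Continuous.continuousOn ?_) fun t ht => seg_mem ht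
  exact ((continuous_piSingle a).comp (continuous_const.sub continuous_id)).add
    (continuous_piSingle b)

theorem seg_right {a b : Fin 4} (hab : a ≠ b) {t : ℝ} (ht : t ∈ Icc (0 : ℝ) 1) : (seg a b t).1 b = t := by
  simp [seg_val ht, hab]

theorem seg_left {a b : Fin 4} (hab : a ≠ b) {t : ℝ} (ht : t ∈ Icc (0 : ℝ) 1) :
    (seg a b t).1 a = 1 - t := by
  simp [seg_val ht, hab]

theorem supp_seg_subset {a b : Fin 4} {t : ℝ} (ht : t ∈ Icc (0 : ℝ) 1) : supp (seg a b t) ⊆ {a, b} := by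
  intro k hk
  by_contra h
  simp only [Finset.mem_insert, Finset.mem_singleton, not_or] at h
  rw [mem_supp, seg_val ht] at hk
  simp [h.1, h.2] at hk

theorem supp_seg {a b : Fin 4} (hab : a ≠ b) {t : ℝ} (ht : t ∈ Ioo (0 : ℝ) 1) :
    supp (seg a b t) = {a, b} := by
  have ht' := Ioo_subset_Icc_self ht
  refine (supp_seg_subset ht').antisymm fun k hk => ?_
  rw [mem_supp]
  simp only [Finset.mem_insert, Finset.mem_singleton] at hk
  rcases hk with rfl | rfl
  · rw [seg_left hab ht']; linarith [ht.2]
  · rw [seg_right hab ht']; exact ht.1.ne'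

theorem card_supp_seg {a b : Fin 4} (hab : a ≠ b) {t : ℝ} (ht : t = 0 ∨ t = 1) :
    (supp (seg a b t)).card = 1 := by
  have ht' : t ∈ Icc (0 : ℝ) 1 := by rcases ht with rfl | rfl <;> simp
  rw [Finset.card_eq_one]
  rcases ht with rfl | rfl
  · refine ⟨a, (Finset.subset_singleton_iff.1 fun k hk => ?_).resolve_left (supp_nonempty _).ne_empty⟩
    rcases Finset.mem_insert.1 (supp_seg_subset ht' hk) with rfl | h
    · exact Finset.mem_singleton_self _
    · rw [Finset.mem_singleton.1 h, mem_supp, seg_right hab ht'] at hk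
      exact absurd rfl hk
  · refine ⟨b, (Finset.subset_singleton_iff.1 fun k hk => ?_).resolve_left (supp_nonempty _).ne_empty⟩
    rcases Finset.mem_insert.1 (supp_seg_subset ht' hk) with rfl | h
    · rw [mem_supp, seg_left hab ht'] at hk
      simp at hk
    · exact h

theorem exists_seg_eq {a b : Fin 4} (hab : a ≠ b) {x : Tet} (hx : supp x = {a, b}) :
    ∃ t ∈ Ioo (0 : ℝ) 1, seg a b t = x := by
  have hs := sum_eq_one_of_supp_subset hx.subset
  rw [Finset.sum_pair hab] at hs
  have ha : 0 < x.1 a := (x.2.1 a).lt_of_ne' (mem_supp.1 (by simp [hx]))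
  have hb : 0 < x.1 b := (x.2.1 b).lt_of_ne' (mem_supp.1 (by simp [hx]))
  have ht : x.1 b ∈ Ioo (0 : ℝ) 1 := ⟨hb, by linarith⟩
  have ht' := Ioo_subset_Icc_self ht
  refine ⟨x.1 b, ht, tet_ext_of_supp_subset (supp_seg_subset ht') hx.subset fun k hk => ?_⟩
  rcases Finset.mem_insert.1 hk with rfl | h
  · rw [seg_left hab ht']; linarith
  · rw [Finset.mem_singleton.1 h, seg_right hab ht']

theorem seg_injOn {a b : Fin 4} (hab : a ≠ b) : InjOn (seg a b) (Icc 0 1) := by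
  intro t ht t' ht' h
  rw [← seg_right hab ht, h, seg_right hab ht']

/-- The points of the triangle `abc`. -/
def tri (a b c : Fin 4) (p : ℝ × ℝ) : Tet :=
  toTet (Pi.single a (1 - p.1 - p.2) + Pi.single b p.1 + Pi.single c p.2)

/-- The standard triangle in the plane. -/
def planeTriangle : Set (ℝ × ℝ) := {p | 0 ≤ p.1 ∧ 0 ≤ p.2 ∧ p.1 + p.2 ≤ 1}

theorem tri_mem {a b c : Fin 4} {p : ℝ × ℝ} (hp : p ∈ planeTriangle) :
    (Pi.single a (1 - p.1 - p.2) + Pi.single b p.1 + Pi.single c p.2 : Fin 4 → ℝ) ∈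
      stdSimplex ℝ (Fin 4) := by
  obtain ⟨h1, h2, h3⟩ := hp
  refine ⟨fun k => ?_, ?_⟩
  · simp only [Pi.add_apply, Pi.single_apply]
    split_ifs <;> linarith
  · simp [Finset.sum_add_distrib]
    ring

theorem tri_val {a b c : Fin 4} {p : ℝ × ℝ} (hp : p ∈ planeTriangle) :
    (tri a b c p).1 = Pi.single a (1 - p.1 - p.2) + Pi.single b p.1 + Pi.single c p.2 :=
  toTet_val (tri_mem hp)

theorem continuousOn_tri (a b c : Fin 4) : ContinuousOn (tri a b c) planeTriangle := by
  refine continuousOn_toTet.comp (Continuous.continuousOn ?_) fun t ht => tri_mem ht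
  exact (((continuous_piSingle a).comp ((continuous_const.sub continuous_fst).sub
    continuous_snd)).add ((continuous_piSingle b).comp continuous_fst)).add
    ((continuous_piSingle c).comp continuous_snd)

theorem tri_snd {a b c : Fin 4} (hab : a ≠ b) (hbc : b ≠ c) {p : ℝ × ℝ} (hp : p ∈ planeTriangle) : (tri a b c p).1 b = p.1 := by
  simp [tri_val hp, hab, hbc]

theorem tri_trd {a b c : Fin 4} (hac : a ≠ c) (hbc : b ≠ c) {p : ℝ × ℝ} (hp : p ∈ planeTriangle) : (tri a b c p).1 c = p.2 := by
  simp [tri_val hp, hac, hbc]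

theorem tri_fst {a b c : Fin 4} (hab : a ≠ b) (hac : a ≠ c) {p : ℝ × ℝ} (hp : p ∈ planeTriangle) : (tri a b c p).1 a = 1 - p.1 - p.2 := by
  simp [tri_val hp, hab, hac]

section

variable {a b c : Fin 4} (hab : a ≠ b) (hac : a ≠ c) (hbc : b ≠ c)
include hab hac hbc

theorem mem_supp_tri {p : ℝ × ℝ} (hp : p ∈ planeTriangle) {k : Fin 4} :
    k ∈ supp (tri a b c p) ↔
      (k = a ∧ p.1 + p.2 ≠ 1) ∨ (k = b ∧ p.1 ≠ 0) ∨ (k = c ∧ p.2 ≠ 0) := by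
  rw [mem_supp, tri_val hp]
  have h1 : 1 - p.1 - p.2 = 0 ↔ p.1 + p.2 = 1 := ⟨fun h => by linarith, fun h => by linarith⟩
  simp only [Pi.add_apply, Pi.single_apply]
  by_cases hka : k = a
  · subst hka; simp [hab, hac, h1]
  · by_cases hkb : k = b
    · subst hkb; simp [hka, hbc]
    · simp [hka, hkb]

theorem supp_tri_subset {p : ℝ × ℝ} (hp : p ∈ planeTriangle) : supp (tri a b c p) ⊆ {a, b, c} := by
  intro k hk
  rw [mem_supp_tri hab hac hbc hp] at hk
  simp only [Finset.mem_insert, Finset.mem_singleton]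
  tauto

theorem tri_injOn : InjOn (tri a b c) planeTriangle := by
  intro p hp q hq h
  refine Prod.ext ?_ ?_
  · rw [← tri_snd hab hbc hp, h, tri_snd hab hbc hq]
  · rw [← tri_trd hac hbc hp, h, tri_trd hac hbc hq]

theorem supp_tri_eq_iff {p : ℝ × ℝ} (hp : p ∈ planeTriangle) :
    supp (tri a b c p) = {a, b, c} ↔ p.1 ≠ 0 ∧ p.2 ≠ 0 ∧ p.1 + p.2 ≠ 1 := by
  constructor
  · intro h
    have ha : a ∈ supp (tri a b c p) := by simp [h]
    have hb : b ∈ supp (tri a b c p) := by simp [h]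
    have hc : c ∈ supp (tri a b c p) := by simp [h]
    rw [mem_supp_tri hab hac hbc hp] at ha hb hc
    simp [hab, hac, hbc, hab.symm, hac.symm, hbc.symm] at ha hb hc
    exact ⟨hb, hc, ha⟩
  · rintro ⟨h1, h2, h3⟩
    ext k
    rw [mem_supp_tri hab hac hbc hp]
    simp [h1, h2, h3]

theorem exists_tri_eq {x : Tet} (hx : supp x = {a, b, c}) :
    ∃ p ∈ planeTriangle, tri a b c p = x := by
  have hs := sum_eq_one_of_supp_subset hx.subset
  rw [Finset.sum_insert (by simp [hab, hac]), Finset.sum_pair hbc] at hs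
  have hp : (x.1 b, x.1 c) ∈ planeTriangle :=
    ⟨x.2.1 b, x.2.1 c, by have := x.2.1 a; simp only; linarith⟩
  refine ⟨(x.1 b, x.1 c), hp, ?_⟩
  refine tet_ext_of_supp_subset (supp_tri_subset hab hac hbc hp) hx.subset fun k hk => ?_
  simp only [Finset.mem_insert, Finset.mem_singleton] at hk
  rcases hk with rfl | rfl | rfl
  · rw [tri_fst hab hac hp]; linarith
  · rw [tri_snd hab hbc hp]
  · rw [tri_trd hac hbc hp]

theorem card_supp_tri_two {p : ℝ × ℝ} (hp : p ∈ planeTriangle)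
    (h : p.1 = 0 ∨ p.2 = 0 ∨ p.1 + p.2 = 1) (h0 : p ≠ (0, 0)) (h1 : p ≠ (1, 0)) (h2 : p ≠ (0, 1)) :
    (supp (tri a b c p)).card = 2 := by
  obtain ⟨u, v⟩ := p
  simp only [ne_eq, Prod.mk.injEq, not_and] at h0 h1 h2 h
  have key : ∀ {d e}, d ≠ e → (∀ k, k ∈ supp (tri a b c (u, v)) ↔ k = d ∨ k = e) →
      (supp (tri a b c (u, v))).card = 2 := fun {d e} hde hk => by
    have : supp (tri a b c (u, v)) = {d, e} := by ext k; simp [hk]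
    rw [this, Finset.card_pair hde]
  rcases h with rfl | rfl | h
  · refine key hac fun k => ?_
    rw [mem_supp_tri hab hac hbc hp]
    simp only [zero_add, ne_eq, not_true, and_false, false_or]
    simp [h0 rfl, h2 rfl]
  · have hu0 : u ≠ 0 := fun h => h0 h rfl
    have hu1 : u ≠ 1 := fun h => h1 h rfl
    refine key hab fun k => ?_
    rw [mem_supp_tri hab hac hbc hp]
    simp [hu0, hu1]
  · have hu0 : u ≠ 0 := fun hu => h2 hu (by linarith)
    have hv0 : v ≠ 0 := fun hv => h1 (by linarith) hv
    refine key hbc fun k => ?_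
    rw [mem_supp_tri hab hac hbc hp]
    simp [hu0, hv0, h]

theorem card_supp_tri_one {p : ℝ × ℝ} (h : p = (0, 0) ∨ p = (1, 0) ∨ p = (0, 1)) :
    (supp (tri a b c p)).card = 1 := by
  have hp : p ∈ planeTriangle := by
    rcases h with rfl | rfl | rfl <;> simp [planeTriangle]
  rw [Finset.card_eq_one]
  rcases h with rfl | rfl | rfl
  · exact ⟨a, by ext k; rw [mem_supp_tri hab hac hbc hp]; simp⟩
  · exact ⟨b, by ext k; rw [mem_supp_tri hab hac hbc hp]; simp⟩
  · exact ⟨c, by ext k; rw [mem_supp_tri hab hac hbc hp]; simp⟩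

end

theorem convexHull_planeTriangle :
    convexHull ℝ (({(0, 0), (1, 0), (0, 1)} : Finset (ℝ × ℝ)) : Set (ℝ × ℝ)) = planeTriangle := by
  apply Subset.antisymm
  · refine convexHull_min ?_ ?_
    · intro p hp
      simp only [Finset.coe_insert, Finset.coe_singleton, mem_insert_iff, mem_singleton_iff] at hp
      rcases hp with rfl | rfl | rfl <;> simp [planeTriangle]
    · rintro p ⟨h1, h2, h3⟩ q ⟨h1', h2', h3'⟩ s t hs ht hst
      refine ⟨?_, ?_, ?_⟩
      · change 0 ≤ s * p.1 + t * q.1; positivity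
      · change 0 ≤ s * p.2 + t * q.2; positivity
      · change s * p.1 + t * q.1 + (s * p.2 + t * q.2) ≤ 1
        nlinarith [mul_le_mul_of_nonneg_left h3 hs, mul_le_mul_of_nonneg_left h3' ht]
  · rintro p ⟨h1, h2, h3⟩
    have hsub := subset_convexHull ℝ (({(0, 0), (1, 0), (0, 1)} : Finset (ℝ × ℝ)) : Set (ℝ × ℝ))
    have := (convex_convexHull ℝ (({(0, 0), (1, 0), (0, 1)} : Finset (ℝ × ℝ)) : Set (ℝ × ℝ))).sum_mem
      (t := Finset.univ) (w := ![1 - p.1 - p.2, p.1, p.2]) (z := ![(0, 0), (1, 0), (0, 1)])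
      (by intro k _; fin_cases k <;> simp <;> linarith)
      (by simp [Fin.sum_univ_three]; ring) (by intro k _; fin_cases k <;> exact hsub (by simp))
    convert this using 1
    simp [Fin.sum_univ_three]

theorem isClosed_planeTriangle : IsClosed planeTriangle :=
  (isClosed_le continuous_const continuous_fst).inter
    ((isClosed_le continuous_const continuous_snd).inter
      (isClosed_le (continuous_fst.add continuous_snd) continuous_const))

theorem interior_planeTriangle :
    interior planeTriangle = {p : ℝ × ℝ | 0 < p.1 ∧ 0 < p.2 ∧ p.1 + p.2 < 1} := by
  apply Subset.antisymm
  · intro p hp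
    -- Moving along (1, 1) tests all three inequalities at once: forwards the hypotenuse, backwards
    -- the two legs.
    have hc : ContinuousAt (fun t : ℝ => (p.1 + t, p.2 + t)) 0 := by fun_prop
    have h1 : ∀ᶠ t : ℝ in nhds 0, (p.1 + t, p.2 + t) ∈ planeTriangle := by
      refine hc.eventually (mem_interior_iff_mem_nhds.1 ?_)
      simpa using hp
    obtain ⟨ε, hε, h⟩ := Metric.eventually_nhds_iff.1 h1
    have h2 := h (y := ε / 2) (by rw [dist_zero_right, Real.norm_eq_abs, abs_of_pos (by positivity)]; linarith)
    have h3 := h (y := -(ε / 2)) (by rw [dist_zero_right, norm_neg, Real.norm_eq_abs, abs_of_pos (by positivity)]; linarith)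
    obtain ⟨-, -, h2⟩ := h2
    obtain ⟨h3, h4, -⟩ := h3
    simp only at h2 h3 h4
    exact ⟨by linarith, by linarith, by linarith⟩
  · refine interior_maximal (fun p hp => ⟨hp.1.le, hp.2.1.le, hp.2.2.le⟩) ?_
    exact (isOpen_lt continuous_const continuous_fst).inter
      ((isOpen_lt continuous_const continuous_snd).inter
        (isOpen_lt (continuous_fst.add continuous_snd) continuous_const))

theorem convexHull_square :
    convexHull ℝ ((({0, 1} : Finset ℝ) ×ˢ ({0, 1} : Finset ℝ) : Finset (ℝ × ℝ)) : Set (ℝ × ℝ)) =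
      Icc 0 1 ×ˢ Icc 0 1 := by
  rw [Finset.coe_product, convexHull_prod]
  simp [convexHull_pair, segment_eq_Icc]

/-! ### The model polygons -/

namespace DiscType

theorem supp_inter_side {τ : DiscType} {z : Tet × Tet} (hz : z ∈ τ.model) :
    (supp z.1 ∪ supp z.2) ∩ τ.side = supp z.1 := by
  rw [Finset.union_inter_distrib_right, Finset.inter_eq_left.2 hz.1,
    Finset.disjoint_iff_inter_eq_empty.1 (disjoint_compl_left.mono_left hz.2),
    Finset.union_empty]

theorem supp_inter_compl {τ : DiscType} {z : Tet × Tet} (hz : z ∈ τ.model) :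
    (supp z.1 ∪ supp z.2) ∩ τ.sideᶜ = supp z.2 := by
  rw [Finset.union_inter_distrib_right, Finset.inter_eq_left.2 hz.2,
    Finset.disjoint_iff_inter_eq_empty.1 (disjoint_compl_right.mono_left hz.1),
    Finset.empty_union]

theorem disjoint_supp {τ : DiscType} {z : Tet × Tet} (hz : z ∈ τ.model) :
    Disjoint (supp z.1) (supp z.2) :=
  disjoint_compl_right.mono hz.1 hz.2

theorem card_supp_union {τ : DiscType} {z : Tet × Tet} (hz : z ∈ τ.model) :
    (supp z.1 ∪ supp z.2).card = (supp z.1).card + (supp z.2).card :=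
  Finset.card_union_of_disjoint (disjoint_supp hz)

/-- The open face of the model polygon that is mapped to the open simplex spanned by `s`. -/
theorem setOf_model_eq (τ : DiscType) (s : Finset (Fin 4)) :
    {z ∈ τ.model | supp z.1 ∪ supp z.2 = s} = {z | supp z.1 = s ∩ τ.side ∧ supp z.2 = s ∩ τ.sideᶜ} := by
  ext z
  constructor
  · rintro ⟨hz, rfl⟩
    exact ⟨(supp_inter_side hz).symm, (supp_inter_compl hz).symm⟩
  · rintro ⟨h1, h2⟩
    refine ⟨⟨h1 ▸ Finset.inter_subset_right, h2 ▸ Finset.inter_subset_right⟩, ?_⟩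
    rw [h1, h2, ← Finset.inter_union_distrib_left, Finset.union_compl, Finset.inter_univ]

theorem meets_iff {τ : DiscType} {s : Finset (Fin 4)} :
    τ.Meets s ↔ (s ∩ τ.sideᶜ).Nonempty ∧ (s ∩ τ.side).Nonempty := by
  rw [Meets, Finset.not_subset, Finset.not_subset]
  simp [Finset.Nonempty]

theorem eq_of_meets_iff {τ τ' : DiscType} (h : ∀ s, τ.Meets s ↔ τ'.Meets s) : τ = τ' := by
  revert τ τ'
  decide

/-- The open edges of the model polygon, with their end points. -/
theorem exists_edge_param {u v : Finset (Fin 4)} (hu : u.Nonempty) (hv : v.Nonempty)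
    (huv : u.card + v.card = 3) :
    ∃ g : ℝ → Tet × Tet, ContinuousOn g (Icc 0 1) ∧ InjOn g (Icc 0 1) ∧
      (∀ t ∈ Icc (0 : ℝ) 1, supp (g t).1 ⊆ u ∧ supp (g t).2 ⊆ v) ∧
      g '' Ioo 0 1 = {z | supp z.1 = u ∧ supp z.2 = v} ∧
      (∀ t, t = 0 ∨ t = 1 → (supp (g t).1).card + (supp (g t).2).card = 2) := by
  have hu' := hu.card_pos
  have hv' := hv.card_pos
  -- An open side of a product of simplices is a vertex times an open edge, in one order or the
  -- other.
  obtain ⟨h1, h2⟩ | ⟨h1, h2⟩ : (u.card = 1 ∧ v.card = 2) ∨ (u.card = 2 ∧ v.card = 1) := by omega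
  · obtain ⟨a, b, hab, rfl⟩ := Finset.card_eq_two.1 h2
    obtain ⟨x, hx⟩ := exists_supp_eq hu
    obtain ⟨c, rfl⟩ := Finset.card_eq_one.1 h1
    refine ⟨fun t => (x, seg a b t), continuousOn_const.prodMk (continuousOn_seg a b),
      fun s hs t ht h => seg_injOn hab hs ht (Prod.ext_iff.1 h).2,
      fun t ht => ⟨hx.subset, supp_seg_subset ht⟩, ?_, fun t ht => ?_⟩
    · ext ⟨y, z⟩
      constructor
      · rintro ⟨t, ht, h⟩
        cases h
        exact ⟨hx, supp_seg hab ht⟩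
      · rintro ⟨hy, hz⟩
        obtain ⟨t, ht, rfl⟩ := exists_seg_eq hab hz
        exact ⟨t, ht, Prod.ext (eq_of_supp_subset_singleton hx.subset hy.subset) rfl⟩
    · rw [hx, card_supp_seg hab ht, Finset.card_singleton]
  · obtain ⟨a, b, hab, rfl⟩ := Finset.card_eq_two.1 h1
    obtain ⟨x, hx⟩ := exists_supp_eq hv
    obtain ⟨c, rfl⟩ := Finset.card_eq_one.1 h2
    refine ⟨fun t => (seg a b t, x), (continuousOn_seg a b).prodMk continuousOn_const,
      fun s hs t ht h => seg_injOn hab hs ht (Prod.ext_iff.1 h).1,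
      fun t ht => ⟨supp_seg_subset ht, hx.subset⟩, ?_, fun t ht => ?_⟩
    · ext ⟨z, y⟩
      constructor
      · rintro ⟨t, ht, h⟩
        cases h
        exact ⟨supp_seg hab ht, hx⟩
      · rintro ⟨hz, hy⟩
        obtain ⟨t, ht, rfl⟩ := exists_seg_eq hab hz
        exact ⟨t, ht, Prod.ext rfl (eq_of_supp_subset_singleton hx.subset hy.subset)⟩
    · rw [hx, card_supp_seg hab ht, Finset.card_singleton]

/-- The model polygon is parametrized by a convex polygon in the plane. -/
def IsPolygonParam (τ : DiscType) (P : Finset (ℝ × ℝ)) (h : ℝ × ℝ → Tet × Tet) : Prop :=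
  (interior (convexHull ℝ (P : Set (ℝ × ℝ)))).Nonempty ∧
  ContinuousOn h (convexHull ℝ (P : Set (ℝ × ℝ))) ∧
  InjOn h (convexHull ℝ (P : Set (ℝ × ℝ))) ∧
  MapsTo h (convexHull ℝ (P : Set (ℝ × ℝ))) τ.model ∧
  h '' interior (convexHull ℝ (P : Set (ℝ × ℝ))) = {z | supp z.1 = τ.side ∧ supp z.2 = τ.sideᶜ} ∧
  ∀ p ∈ frontier (convexHull ℝ (P : Set (ℝ × ℝ))),
    (p ∈ P → (supp (h p).1).card + (supp (h p).2).card = 2) ∧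
    (p ∉ P → (supp (h p).1).card + (supp (h p).2).card = 3)

theorem exists_isPolygonParam_inl (v : Fin 4) : ∃ P h, IsPolygonParam (Sum.inl v) P h := by
  obtain ⟨x, hx⟩ := exists_supp_eq (Finset.singleton_nonempty v)
  obtain ⟨a, b, c, hab, hac, hbc, habc⟩ := Finset.card_eq_three.1
    (show ({v}ᶜ : Finset (Fin 4)).card = 3 by rw [Finset.card_compl]; rfl)
  refine ⟨{(0, 0), (1, 0), (0, 1)}, fun p => (x, tri a b c p), ?_⟩
  rw [IsPolygonParam, convexHull_planeTriangle, isClosed_planeTriangle.frontier_eq, interior_planeTriangle]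
  refine ⟨⟨(1 / 3, 1 / 3), by norm_num⟩, continuousOn_const.prodMk (continuousOn_tri a b c),
    fun p hp q hq h => tri_injOn hab hac hbc hp hq (Prod.ext_iff.1 h).2,
    fun p hp => ⟨hx.subset, ?_⟩, ?_, ?_⟩
  · change supp (tri a b c p) ⊆ ({v}ᶜ : Finset (Fin 4))
    rw [habc]
    exact supp_tri_subset hab hac hbc hp
  · ext ⟨y, z⟩
    change _ ↔ supp y = {v} ∧ supp z = {v}ᶜ
    rw [habc]
    constructor
    · rintro ⟨p, ⟨h1, h2, h3⟩, h⟩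
      cases h
      exact ⟨hx, (supp_tri_eq_iff hab hac hbc ⟨h1.le, h2.le, h3.le⟩).2 ⟨h1.ne', h2.ne', h3.ne⟩⟩
    · rintro ⟨hy, hz⟩
      obtain ⟨p, hp, rfl⟩ := exists_tri_eq hab hac hbc hz
      obtain ⟨h1, h2, h3⟩ := (supp_tri_eq_iff hab hac hbc hp).1 hz
      exact ⟨p, ⟨hp.1.lt_of_ne' h1, hp.2.1.lt_of_ne' h2, hp.2.2.lt_of_ne h3⟩,
        Prod.ext (eq_of_supp_subset_singleton hx.subset hy.subset) rfl⟩
  · rintro p ⟨hp, hp'⟩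
    simp only [Finset.mem_insert, Finset.mem_singleton, hx, Finset.card_singleton]
    constructor
    · intro h
      rw [card_supp_tri_one hab hac hbc h]
    · intro h
      simp only [not_or] at h
      rw [card_supp_tri_two hab hac hbc hp ?_ h.1 h.2.1 h.2.2]
      by_contra! hne
      exact hp' ⟨hp.1.lt_of_ne' hne.1, hp.2.1.lt_of_ne' hne.2.1, hp.2.2.lt_of_ne hne.2.2⟩

theorem exists_isPolygonParam_inr (k : Fin 3) : ∃ P h, IsPolygonParam (Sum.inr k) P h := by
  have hk : ({0, k.succ} : Finset (Fin 4)).card = 2 := Finset.card_pair (Fin.succ_ne_zero k).symm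
  obtain ⟨a, b, hab, hab'⟩ := Finset.card_eq_two.1 hk
  obtain ⟨c, d, hcd, hcd'⟩ := Finset.card_eq_two.1
    (show ({0, k.succ}ᶜ : Finset (Fin 4)).card = 2 by rw [Finset.card_compl, hk]; rfl)
  refine ⟨{0, 1} ×ˢ {0, 1}, fun p => (seg a b p.1, seg c d p.2), ?_⟩
  rw [IsPolygonParam, convexHull_square, (isClosed_Icc.prod isClosed_Icc).frontier_eq, interior_prod_eq,
    interior_Icc]
  refine ⟨⟨(1 / 2, 1 / 2), by constructor <;> norm_num⟩, ?_, ?_, fun p hp => ⟨?_, ?_⟩, ?_, ?_⟩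
  · exact ((continuousOn_seg a b).comp continuousOn_fst fun p hp => hp.1).prodMk
      ((continuousOn_seg c d).comp continuousOn_snd fun p hp => hp.2)
  · intro p hp q hq h
    exact Prod.ext (seg_injOn hab hp.1 hq.1 (Prod.ext_iff.1 h).1) (seg_injOn hcd hp.2 hq.2 (Prod.ext_iff.1 h).2)
  · change supp (seg a b p.1) ⊆ ({0, k.succ} : Finset (Fin 4))
    rw [hab']
    exact supp_seg_subset hp.1
  · change supp (seg c d p.2) ⊆ ({0, k.succ}ᶜ : Finset (Fin 4))
    rw [hcd']
    exact supp_seg_subset hp.2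
  · ext ⟨y, z⟩
    change _ ↔ supp y = {0, k.succ} ∧ supp z = {0, k.succ}ᶜ
    rw [hcd', hab']
    constructor
    · rintro ⟨p, ⟨h1, h2⟩, h⟩
      cases h
      exact ⟨supp_seg hab h1, supp_seg hcd h2⟩
    · rintro ⟨hy, hz⟩
      obtain ⟨s, hs, rfl⟩ := exists_seg_eq hab hy
      obtain ⟨t, ht, rfl⟩ := exists_seg_eq hcd hz
      exact ⟨(s, t), ⟨hs, ht⟩, rfl⟩
  · rintro ⟨s, t⟩ ⟨⟨hs, ht⟩, hp'⟩
    simp only at hs ht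
    simp only [Finset.mem_product, Finset.mem_insert, Finset.mem_singleton]
    have key : ∀ r ∈ Icc (0 : ℝ) 1, ¬ (r = 0 ∨ r = 1) → r ∈ Ioo (0 : ℝ) 1 := by
      intro r hr h
      rw [not_or] at h
      exact ⟨hr.1.lt_of_ne' h.1, hr.2.lt_of_ne h.2⟩
    constructor
    · rintro ⟨h1, h2⟩
      rw [card_supp_seg hab h1, card_supp_seg hcd h2]
    · intro h
      by_cases h1 : s = 0 ∨ s = 1
      · have h2 : ¬ (t = 0 ∨ t = 1) := fun h2 => h ⟨h1, h2⟩
        rw [card_supp_seg hab h1, supp_seg hcd (key t ht h2), Finset.card_pair hcd]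
      · by_cases h2 : t = 0 ∨ t = 1
        · rw [card_supp_seg hcd h2, supp_seg hab (key s hs h1), Finset.card_pair hab]
        · exact absurd ⟨key s hs h1, key t ht h2⟩ hp'

theorem exists_isPolygonParam (τ : DiscType) : ∃ P h, IsPolygonParam τ P h := by
  rcases τ with v | k
  · exact exists_isPolygonParam_inl v
  · exact exists_isPolygonParam_inr k

end DiscType

/-! ### Normal discs -/

namespace IsNormalDisc

variable {τ : DiscType} {D : Set Tet}

/-- The disc meets the open simplex s in the image of the product of the open simplices spanned by
the parts of s on the two sides; this is nonempty exactly when both parts are. -/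
theorem nonempty_iff_meets (h : IsNormalDisc τ D) (s : Finset (Fin 4)) :
    {x ∈ D | supp x = s}.Nonempty ↔ τ.Meets s := by
  obtain ⟨φ, -, -, rfl, hφ⟩ := h
  rw [DiscType.meets_iff]
  constructor
  · rintro ⟨_, ⟨z, hz, rfl⟩, rfl⟩
    rw [hφ z hz, DiscType.supp_inter_side hz, DiscType.supp_inter_compl hz]
    exact ⟨supp_nonempty _, supp_nonempty _⟩
  · rintro ⟨h1, h2⟩
    obtain ⟨x, hx⟩ := exists_supp_eq h2
    obtain ⟨y, hy⟩ := exists_supp_eq h1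
    have : (x, y) ∈ {z ∈ τ.model | supp z.1 ∪ supp z.2 = s} := by
      rw [DiscType.setOf_model_eq]; exact ⟨hx, hy⟩
    exact ⟨φ (x, y), ⟨_, this.1, rfl⟩, by rw [hφ _ this.1, this.2]⟩

theorem type_unique {τ' : DiscType} (h : IsNormalDisc τ D) (h' : IsNormalDisc τ' D) : τ = τ' :=
  DiscType.eq_of_meets_iff fun s => (h.nonempty_iff_meets s).symm.trans (h'.nonempty_iff_meets s)

theorem two_le_card (h : IsNormalDisc τ D) {x : Tet} (hx : x ∈ D) : 2 ≤ (supp x).card := by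
  obtain ⟨φ, -, -, rfl, hφ⟩ := h
  obtain ⟨z, hz, rfl⟩ := hx
  rw [hφ z hz, DiscType.card_supp_union hz]
  have h1 := (supp_nonempty z.1).card_pos
  have h2 := (supp_nonempty z.2).card_pos
  omega

/-- Such a part of a disc is the continuous image of a product of two convex sets, or empty. -/
theorem isPreconnected_setOf (h : IsNormalDisc τ D) (s : Finset (Fin 4)) :
    IsPreconnected {x ∈ D | supp x = s} := by
  obtain ⟨φ, hc, -, rfl, hφ⟩ := h
  have : {x ∈ φ '' τ.model | supp x = s} = φ '' {z ∈ τ.model | supp z.1 ∪ supp z.2 = s} := by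
    ext x
    constructor
    · rintro ⟨⟨z, hz, rfl⟩, rfl⟩
      exact ⟨z, ⟨hz, (hφ z hz).symm⟩, rfl⟩
    · rintro ⟨z, ⟨hz, rfl⟩, rfl⟩
      exact ⟨⟨z, hz, rfl⟩, hφ z hz⟩
  rw [this]
  refine IsPreconnected.image ?_ _ (hc.mono fun z hz => hz.1)
  rw [DiscType.setOf_model_eq]
  exact (isPreconnected_setOf_supp_eq (s ∩ τ.side)).prod (isPreconnected_setOf_supp_eq (s ∩ τ.sideᶜ))

/-- Over an edge both factors are single vertices, so the open face of the model is one point. -/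
theorem subsingleton_setOf (h : IsNormalDisc τ D) {s : Finset (Fin 4)} (hs : s.card = 2) :
    {x ∈ D | supp x = s}.Subsingleton := by
  obtain ⟨φ, -, -, rfl, hφ⟩ := h
  rintro _ ⟨⟨z, hz, rfl⟩, h1⟩ _ ⟨⟨z', hz', rfl⟩, h2⟩
  rw [hφ _ hz] at h1
  rw [hφ _ hz'] at h2
  have c1 := DiscType.card_supp_union hz
  rw [h1, hs] at c1
  have p1 := (supp_nonempty z.1).card_pos
  have p2 := (supp_nonempty z.2).card_pos
  obtain ⟨a, ha⟩ := Finset.card_eq_one.1 (show (supp z.1).card = 1 by omega)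
  obtain ⟨b, hb⟩ := Finset.card_eq_one.1 (show (supp z.2).card = 1 by omega)
  have ha' : supp z'.1 = {a} := by rw [← ha, ← DiscType.supp_inter_side hz', ← DiscType.supp_inter_side hz, h1, h2]
  have hb' : supp z'.2 = {b} := by rw [← hb, ← DiscType.supp_inter_compl hz', ← DiscType.supp_inter_compl hz, h1, h2]
  rw [Prod.ext (eq_of_supp_subset_singleton ha.subset ha'.subset)
    (eq_of_supp_subset_singleton hb.subset hb'.subset)]

end IsNormalDisc

namespace Triangulation

variable {n : ℕ} {T : Triangulation n} {S : Set T.Space}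

/-! ### The cells of a normal surface -/

variable (T S) in
/-- The component of the part of `S` in the `i`th tetrahedron that contains a point. -/
def discAt (i : Fin n) (x : Tet) : Set Tet := connectedComponentIn (T.incl i ⁻¹' S) x

variable (T S) in
/-- The cell that contains the image of a point of the `i`th tetrahedron. -/
def cellAt (p : Fin n × Tet) : Set T.Space :=
  T.incl p.1 '' {z ∈ T.discAt S p.1 p.2 | supp z = supp p.2}

theorem discAt_mem {i : Fin n} {x : Tet} (hx : T.incl i x ∈ S) : T.discAt S i x ∈ T.discs S i :=
  ⟨x, hx, rfl⟩

theorem mem_discAt {i : Fin n} {x : Tet} (hx : T.incl i x ∈ S) : x ∈ T.discAt S i x :=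
  mem_connectedComponentIn hx

theorem incl_mem_of_mem_discAt {i : Fin n} {x z : Tet} (hz : z ∈ T.discAt S i x) : T.incl i z ∈ S :=
  connectedComponentIn_subset (T.incl i ⁻¹' S) x hz

theorem discAt_eq {i : Fin n} {x z : Tet} (hz : z ∈ T.discAt S i x) : T.discAt S i x = T.discAt S i z :=
  connectedComponentIn_eq hz

theorem eq_discAt_of_mem {i : Fin n} {D : Set Tet} (hD : D ∈ T.discs S i) {x : Tet} (hx : x ∈ D) :
    D = T.discAt S i x ∧ T.incl i x ∈ S := by
  obtain ⟨y, hy, rfl⟩ := hD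
  exact ⟨discAt_eq hx, incl_mem_of_mem_discAt hx⟩

theorem incl_mem_cellAt {i : Fin n} {x : Tet} (hx : T.incl i x ∈ S) : T.incl i x ∈ T.cellAt S (i, x) :=
  ⟨x, ⟨mem_discAt hx, rfl⟩, rfl⟩

theorem suppCard_of_mem_cellAt {p : Fin n × Tet} {y : T.Space} (hy : y ∈ T.cellAt S p) :
    T.suppCard y = (supp p.2).card := by
  obtain ⟨z, ⟨-, hz⟩, rfl⟩ := hy
  rw [suppCard_incl, hz]

theorem cellAt_eq_image {i : Fin n} {D : Set Tet} (hD : D ∈ T.discs S i) {x : Tet} (hx : x ∈ D) :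
    T.incl i '' {z ∈ D | supp z = supp x} = T.cellAt S (i, x) := by
  rw [cellAt, ← (eq_discAt_of_mem hD hx).1]

/-- Any point of a cell determines its disc and its open simplex, so cells can be handled through
points alone. -/
theorem mem_cells_iff {k : ℕ} {C : Set T.Space} :
    C ∈ T.cells S k ↔ ∃ i x, T.incl i x ∈ S ∧ (supp x).card = k + 2 ∧ C = T.cellAt S (i, x) := by
  constructor
  · rintro ⟨h, i, D, hD, s, hs, rfl⟩
    obtain ⟨z, hz, rfl⟩ := h.of_image
    exact ⟨i, z, (eq_discAt_of_mem hD hz).2, hs, cellAt_eq_image hD hz⟩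
  · rintro ⟨i, x, hx, hc, rfl⟩
    exact ⟨⟨_, incl_mem_cellAt hx⟩, i, T.discAt S i x, discAt_mem hx, supp x, hc, rfl⟩

theorem suppCard_of_mem_cells {k : ℕ} {C : Set T.Space} (hC : C ∈ T.cells S k) {p : T.Space} (hp : p ∈ C) :
    T.suppCard p = k + 2 := by
  obtain ⟨i, x, -, hc, rfl⟩ := mem_cells_iff.1 hC
  rw [suppCard_of_mem_cellAt hp, hc]

theorem isPreconnected_cell (hS : T.IsNormalSurface S) {i : Fin n} {x : Tet} (hx : T.incl i x ∈ S)
    (s : Finset (Fin 4)) : IsPreconnected {z ∈ T.discAt S i x | supp z = s} := by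
  obtain ⟨τ, hτ⟩ := (hS i).2 _ (discAt_mem hx)
  exact hτ.isPreconnected_setOf s

/-- The part of the disc in the open simplex is preconnected and lies entirely in the glued face.
Its transport is therefore a preconnected subset of the preimage of S through the second point, and
stays in the component of that point. -/
theorem cellAt_subset_of_glued (hS : T.IsNormalSurface S) {p q : Fin n × Tet} (h : T.Glued p q)
    (hp : T.incl p.1 p.2 ∈ S) : T.cellAt S p ⊆ T.cellAt S q := by
  obtain ⟨i, x⟩ := p
  obtain ⟨j, y⟩ := q
  obtain ⟨f, σ, h1, h2, rfl⟩ := glued_iff.1 h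
  have hz0 : ∀ z, supp z = supp x → z.1 f = 0 := by
    intro z hz
    by_contra h0
    have : f ∈ supp x := hz ▸ mem_supp.2 h0
    exact mem_supp.1 this h2
  have hsub : permTet σ '' {z ∈ T.discAt S i x | supp z = supp x} ⊆ T.discAt S j (permTet σ x) := by
    refine ((isPreconnected_cell hS hp _).image _
      (continuous_permTet σ).continuousOn).subset_connectedComponentIn ⟨x, ⟨mem_discAt hp, rfl⟩, rfl⟩ ?_
    rintro _ ⟨z, ⟨hz, hzs⟩, rfl⟩
    change T.incl j (permTet σ z) ∈ S
    rw [← incl_eq_of_glue h1 (hz0 z hzs)]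
    exact incl_mem_of_mem_discAt hz
  rintro _ ⟨z, hz, rfl⟩
  refine ⟨permTet σ z, ⟨hsub ⟨z, hz, rfl⟩, ?_⟩, (incl_eq_of_glue h1 (hz0 z hz.2)).symm⟩
  rw [supp_permTet, supp_permTet, hz.2]

theorem cellAt_eq_of_incl_eq (hS : T.IsNormalSurface S) {i j : Fin n} {x y : Tet}
    (h : T.incl i x = T.incl j y) (hx : T.incl i x ∈ S) : T.cellAt S (i, x) = T.cellAt S (j, y) := by
  have key : ∀ p q : Fin n × Tet, Relation.EqvGen T.Glued p q → T.incl p.1 p.2 ∈ S →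
      T.cellAt S p = T.cellAt S q := by
    intro p q h
    induction h with
    | rel p q h =>
      intro hp
      have hpq : T.incl p.1 p.2 = T.incl q.1 q.2 := Quot.sound h
      exact (cellAt_subset_of_glued hS h hp).antisymm (cellAt_subset_of_glued hS h.symm (hpq ▸ hp))
    | refl => intro _; rfl
    | symm p q h ih =>
      intro hq
      have hpq : T.incl p.1 p.2 = T.incl q.1 q.2 := incl_eq_iff.2 h
      exact (ih (hpq ▸ hq)).symm
    | trans p q r h h' ih1 ih2 =>
      intro hp
      have hpq : T.incl p.1 p.2 = T.incl q.1 q.2 := incl_eq_iff.2 h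
      exact (ih1 hp).trans (ih2 (hpq ▸ hp))
  exact key _ _ (incl_eq_iff.1 h) hx

theorem cellAt_eq_of_mem (hS : T.IsNormalSurface S) {p : Fin n × Tet} {i : Fin n} {x : Tet}
    (h : T.incl i x ∈ T.cellAt S p) : T.incl i x ∈ S ∧ T.cellAt S p = T.cellAt S (i, x) := by
  obtain ⟨z, ⟨hz, hzs⟩, hzx⟩ := h
  have hzS : T.incl p.1 z ∈ S := incl_mem_of_mem_discAt hz
  have h1 : T.cellAt S p = T.cellAt S (p.1, z) := by
    rw [cellAt, cellAt, discAt_eq hz, hzs]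
  exact ⟨hzx ▸ hzS, h1.trans (cellAt_eq_of_incl_eq hS hzx hzS)⟩

/-- Both are the cell of the common point, by `cellAt_eq_of_mem`, which does not depend on the
chosen representative. -/
theorem cells_eq_of_mem (hS : T.IsNormalSurface S) {k l : ℕ} {C C' : Set T.Space} (hC : C ∈ T.cells S k)
    (hC' : C' ∈ T.cells S l) {p : T.Space} (hp : p ∈ C) (hp' : p ∈ C') : C = C' := by
  obtain ⟨i, x, -, -, rfl⟩ := mem_cells_iff.1 hC
  obtain ⟨j, y, -, -, rfl⟩ := mem_cells_iff.1 hC'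
  obtain ⟨l, z, rfl⟩ := T.exists_incl_eq p
  rw [(cellAt_eq_of_mem hS hp).2, (cellAt_eq_of_mem hS hp').2]

theorem mem_sUnion_cells {k : ℕ} {i : Fin n} {x : Tet} (hx : T.incl i x ∈ S) (hc : (supp x).card = k + 2) :
    T.incl i x ∈ ⋃₀ T.cells S k :=
  ⟨_, mem_cells_iff.2 ⟨i, x, hx, hc, rfl⟩, incl_mem_cellAt hx⟩

theorem disjoint_cells {k l : ℕ} (hkl : k ≠ l) : Disjoint (T.cells S k) (T.cells S l) := by
  rw [Set.disjoint_left]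
  intro C hC hC'
  obtain ⟨p, hp⟩ := hC.1
  have h1 := suppCard_of_mem_cells hC hp
  have h2 := suppCard_of_mem_cells hC' hp
  omega

theorem finite_cells (hS : T.IsNormalSurface S) (k : ℕ) : (T.cells S k).Finite := by
  have : (⋃ i, ⋃ s : Finset (Fin 4), (fun D => T.incl i '' {x ∈ D | supp x = s}) '' T.discs S i).Finite :=
    finite_iUnion fun i => finite_iUnion fun s => (hS i).1.image _
  refine this.subset ?_
  rintro C ⟨-, i, D, hD, s, -, rfl⟩
  exact mem_iUnion.2 ⟨i, mem_iUnion.2 ⟨s, D, hD, rfl⟩⟩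

/-- Cells are the images of the open faces of the model polygon. -/
theorem cellAt_eq_image_model {i : Fin n} {x : Tet} {τ : DiscType} {φ : Tet × Tet → Tet}
    (hφ : φ '' τ.model = T.discAt S i x) (hs : ∀ z ∈ τ.model, supp (φ z) = supp z.1 ∪ supp z.2) :
    T.cellAt S (i, x) = (fun z => T.incl i (φ z)) ''
      {z | supp z.1 = supp x ∩ τ.side ∧ supp z.2 = supp x ∩ τ.sideᶜ} := by
  rw [← DiscType.setOf_model_eq]
  ext p
  constructor
  · rintro ⟨y, ⟨hy, hyx⟩, rfl⟩
    rw [← hφ] at hy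
    obtain ⟨z, hz, rfl⟩ := hy
    exact ⟨z, ⟨hz, by rw [← hs z hz, hyx]⟩, rfl⟩
  · rintro ⟨z, ⟨hz, hzx⟩, rfl⟩
    refine ⟨φ z, ⟨hφ ▸ ⟨z, hz, rfl⟩, ?_⟩, rfl⟩
    rw [hs z hz, hzx]

/-- A side of the model polygon is followed into the quotient. It stays in one open face, where the
quotient map is injective, and ends at corners of the disc. -/
theorem edge_param (hrev : ∀ q : Flag n, ¬ T.FlagEquiv q q.rev) (hS : T.IsNormalSurface S) {i : Fin n}
    {x : Tet} (hx : T.incl i x ∈ S) (hc : (supp x).card = 3) :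
    ∃ γ : ℝ → T.Space, ContinuousOn γ (Icc 0 1) ∧ InjOn γ (Ioo 0 1) ∧
      γ '' Ioo 0 1 = T.cellAt S (i, x) ∧ γ 0 ∈ ⋃₀ T.cells S 0 ∧ γ 1 ∈ ⋃₀ T.cells S 0 := by
  obtain ⟨τ, hτ⟩ := (hS i).2 _ (discAt_mem hx)
  obtain ⟨h1, h2⟩ := DiscType.meets_iff.1 ((hτ.nonempty_iff_meets (supp x)).1 ⟨x, mem_discAt hx, rfl⟩)
  obtain ⟨φ, hφc, hφi, hφD, hφs⟩ := hτ
  have hsum : (supp x ∩ τ.side).card + (supp x ∩ τ.sideᶜ).card = 3 := by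
    rw [← Finset.card_union_of_disjoint (disjoint_compl_right.mono Finset.inter_subset_right
      Finset.inter_subset_right), ← Finset.inter_union_distrib_left, Finset.union_compl,
      Finset.inter_univ, hc]
  obtain ⟨g, hgc, hgi, hgs, hgI, hg2⟩ := DiscType.exists_edge_param h2 h1 hsum
  have hgm : MapsTo g (Icc 0 1) τ.model := fun t ht =>
    ⟨(hgs t ht).1.trans Finset.inter_subset_right, (hgs t ht).2.trans Finset.inter_subset_right⟩
  have hend : ∀ t, t = 0 ∨ t = 1 → T.incl i (φ (g t)) ∈ ⋃₀ T.cells S 0 := by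
    intro t ht
    have hm : g t ∈ τ.model := hgm (by rcases ht with rfl | rfl <;> simp)
    refine mem_sUnion_cells ?_ ?_
    · have : φ (g t) ∈ T.discAt S i x := hφD ▸ mem_image_of_mem φ hm
      exact incl_mem_of_mem_discAt this
    · rw [hφs _ hm, DiscType.card_supp_union hm, hg2 t ht]
  refine ⟨fun t => T.incl i (φ (g t)), ?_, ?_, ?_, hend 0 (Or.inl rfl), hend 1 (Or.inr rfl)⟩
  · exact (T.continuous_incl i).comp_continuousOn (hφc.comp hgc hgm)
  · intro s hs t ht hst
    have hs' := Ioo_subset_Icc_self hs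
    have ht' := Ioo_subset_Icc_self ht
    have e : ∀ t ∈ Ioo (0 : ℝ) 1, supp (φ (g t)) = supp x := by
      intro t ht
      have : g t ∈ {z ∈ τ.model | supp z.1 ∪ supp z.2 = supp x} := by
        rw [DiscType.setOf_model_eq, ← hgI]; exact mem_image_of_mem _ ht
      rw [hφs _ this.1, this.2]
    refine hgi hs' ht' (hφi (hgm hs') (hgm ht') (eq_of_incl_eq hrev hst ?_ ?_))
    · rw [e s hs, e t ht]
    · rw [e s hs, hc]; norm_num
  · rw [cellAt_eq_image_model hφD hφs, ← hgI, image_image]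

theorem face_param (hrev : ∀ q : Flag n, ¬ T.FlagEquiv q q.rev) (hS : T.IsNormalSurface S) {i : Fin n}
    {x : Tet} (hx : T.incl i x ∈ S) (hc : (supp x).card = 4) :
    ∃ (P : Finset (ℝ × ℝ)) (ψ : ℝ × ℝ → T.Space),
    (interior (convexHull ℝ (P : Set (ℝ × ℝ)))).Nonempty ∧
    ContinuousOn ψ (convexHull ℝ (P : Set (ℝ × ℝ))) ∧
    InjOn ψ (interior (convexHull ℝ (P : Set (ℝ × ℝ)))) ∧
    ψ '' interior (convexHull ℝ (P : Set (ℝ × ℝ))) = T.cellAt S (i, x) ∧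
    (∀ p ∈ frontier (convexHull ℝ (P : Set (ℝ × ℝ))), p ∈ P → ψ p ∈ ⋃₀ T.cells S 0) ∧
    (∀ p ∈ frontier (convexHull ℝ (P : Set (ℝ × ℝ))), p ∉ P → ψ p ∈ ⋃₀ T.cells S 1) := by
  obtain ⟨τ, hτ⟩ := (hS i).2 _ (discAt_mem hx)
  obtain ⟨φ, hφc, hφi, hφD, hφs⟩ := hτ
  obtain ⟨P, h, hne, hhc, hhi, hhm, hhI, hhf⟩ := DiscType.exists_isPolygonParam τ
  have hxu : supp x = Finset.univ := (Finset.card_eq_iff_eq_univ _).1 hc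
  have hfr : ∀ p ∈ frontier (convexHull ℝ (P : Set (ℝ × ℝ))), p ∈ convexHull ℝ (P : Set (ℝ × ℝ)) := by
    have : IsClosed (convexHull ℝ (P : Set (ℝ × ℝ))) := P.finite_toSet.isClosed_convexHull ℝ
    exact fun p hp => this.frontier_subset hp
  have hS' : ∀ p ∈ convexHull ℝ (P : Set (ℝ × ℝ)), T.incl i (φ (h p)) ∈ S := by
    intro p hp
    have : φ (h p) ∈ T.discAt S i x := hφD ▸ mem_image_of_mem φ (hhm hp)
    exact incl_mem_of_mem_discAt this
  refine ⟨P, fun p => T.incl i (φ (h p)), hne, ?_, ?_, ?_, fun p hp hpP => ?_, fun p hp hpP => ?_⟩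
  · exact (T.continuous_incl i).comp_continuousOn (hφc.comp hhc hhm)
  · intro p hp q hq hpq
    have hp' := interior_subset hp
    have hq' := interior_subset hq
    have e : ∀ p ∈ interior (convexHull ℝ (P : Set (ℝ × ℝ))), supp (φ (h p)) = supp x := by
      intro p hp
      obtain ⟨h1, h2⟩ : h p ∈ {z : Tet × Tet | supp z.1 = τ.side ∧ supp z.2 = τ.sideᶜ} := by
        rw [← hhI]; exact mem_image_of_mem _ hp
      rw [hφs _ (hhm (interior_subset hp)), h1, h2, Finset.union_compl, hxu]
    refine hhi hp' hq' (hφi (hhm hp') (hhm hq') (eq_of_incl_eq hrev hpq ?_ ?_))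
    · rw [e p hp, e q hq]
    · rw [e p hp, hc]; norm_num
  · rw [cellAt_eq_image_model hφD hφs, hxu, Finset.univ_inter, Finset.univ_inter, ← hhI, image_image]
  · have hm := hhm (hfr p hp)
    refine mem_sUnion_cells (hS' p (hfr p hp)) ?_
    rw [hφs _ hm, DiscType.card_supp_union hm, (hhf p hp).1 hpP]
  · have hm := hhm (hfr p hp)
    refine mem_sUnion_cells (hS' p (hfr p hp)) ?_
    rw [hφs _ hm, DiscType.card_supp_union hm, (hhf p hp).2 hpP]

/-- The cells cover S because discs avoid the vertices of the tetrahedra, so that supports have 2, 3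
or 4 elements; they are disjoint because a point determines its cell. -/
theorem isPolygonalDecomposition_cells (hrev : ∀ q : Flag n, ¬ T.FlagEquiv q q.rev)
    (hS : T.IsNormalSurface S) :
    IsPolygonalDecomposition S (T.cells S 0) (T.cells S 1) (T.cells S 2) where
  finite_vertices := finite_cells hS 0
  finite_edges := finite_cells hS 1
  finite_faces := finite_cells hS 2
  disjoint_VE := disjoint_cells (by norm_num)
  disjoint_VF := disjoint_cells (by norm_num)
  disjoint_EF := disjoint_cells (by norm_num)
  pairwiseDisjoint := by
    have h : ∀ C ∈ T.cells S 0 ∪ T.cells S 1 ∪ T.cells S 2, ∃ k, C ∈ T.cells S k := by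
      rintro C ((h | h) | h)
      exacts [⟨_, h⟩, ⟨_, h⟩, ⟨_, h⟩]
    intro C hC C' hC' hne
    obtain ⟨k, hk⟩ := h C hC
    obtain ⟨l, hl⟩ := h C' hC'
    exact Set.disjoint_left.2 fun p hp hp' => hne (cells_eq_of_mem hS hk hl hp hp')
  sUnion_eq := by
    ext p
    constructor
    · rintro ⟨C, hC, hp⟩
      obtain ⟨k, hk⟩ : ∃ k, C ∈ T.cells S k := by
        rcases hC with (h | h) | h
        exacts [⟨_, h⟩, ⟨_, h⟩, ⟨_, h⟩]
      obtain ⟨i, x, -, -, rfl⟩ := mem_cells_iff.1 hk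
      obtain ⟨j, y, rfl⟩ := T.exists_incl_eq p
      exact (cellAt_eq_of_mem hS hp).1
    · intro hp
      obtain ⟨i, x, rfl⟩ := T.exists_incl_eq p
      obtain ⟨τ, hτ⟩ := (hS i).2 _ (discAt_mem hp)
      have h2 := hτ.two_le_card (mem_discAt hp)
      have h4 : (supp x).card ≤ 4 := (Finset.card_le_univ _).trans_eq (by simp)
      rw [sUnion_union, sUnion_union]
      obtain hc | hc | hc : (supp x).card = 2 ∨ (supp x).card = 3 ∨ (supp x).card = 4 := by omega
      · exact Or.inl (Or.inl (mem_sUnion_cells hp hc))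
      · exact Or.inl (Or.inr (mem_sUnion_cells hp hc))
      · exact Or.inr (mem_sUnion_cells hp hc)
  vertex := by
    intro C hC
    obtain ⟨i, x, hx, hc, rfl⟩ := mem_cells_iff.1 hC
    obtain ⟨τ, hτ⟩ := (hS i).2 _ (discAt_mem hx)
    refine ⟨T.incl i x, Subset.antisymm ?_ (singleton_subset_iff.2 (incl_mem_cellAt hx))⟩
    rintro _ ⟨z, hz, rfl⟩
    rw [hτ.subsingleton_setOf hc hz ⟨mem_discAt hx, rfl⟩]
    rfl
  edge := by
    intro C hC
    obtain ⟨i, x, hx, hc, rfl⟩ := mem_cells_iff.1 hC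
    exact edge_param hrev hS hx hc
  face := by
    intro C hC
    obtain ⟨i, x, hx, hc, rfl⟩ := mem_cells_iff.1 hC
    exact face_param hrev hS hx hc

end Triangulation

namespace Triangulation

variable {n : ℕ} {T : Triangulation n} {S : Set T.Space}

/-! ### Counting the cells -/

theorem edgeDegree_eq {i j : Fin n} {s t : Finset (Fin 4)}
    (h : Relation.EqvGen T.EdgeGlued (i, s) (j, t)) : T.edgeDegree i s = T.edgeDegree j t := by
  have : {q | Relation.EqvGen T.EdgeGlued (i, s) q} = {q | Relation.EqvGen T.EdgeGlued (j, t) q} :=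
    Set.ext fun q => ⟨fun hq => (h.symm _ _).trans _ _ _ hq, fun hq => h.trans _ _ _ hq⟩
  rw [edgeDegree, edgeDegree, this]

/-- The tetrahedra and open simplices in which a given cell can be seen form an equivalence class,
and in each of them the cell comes from exactly one disc. -/
theorem exists_disc_of_cell (hrev : ∀ q : Flag n, ¬ T.FlagEquiv q q.rev) (hS : T.IsNormalSurface S)
    {i : Fin n} {x : Tet} (hx : T.incl i x ∈ S) (hc : 2 ≤ (supp x).card) {j : Fin n} {s : Finset (Fin 4)} :
    (Relation.EqvGen T.EdgeGlued (i, supp x) (j, s) → ∃ D₀ ∈ T.discs S j, ∀ D ∈ T.discs S j,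
      T.incl j '' {y ∈ D | supp y = s} = T.cellAt S (i, x) ↔ D = D₀) ∧
    (∀ D ∈ T.discs S j, T.incl j '' {y ∈ D | supp y = s} = T.cellAt S (i, x) →
      Relation.EqvGen T.EdgeGlued (i, supp x) (j, s)) := by
  have key : ∀ D ∈ T.discs S j, T.incl j '' {y ∈ D | supp y = s} = T.cellAt S (i, x) →
      ∃ y ∈ D, supp y = s ∧ T.incl j y = T.incl i x := by
    intro D _ hD
    obtain ⟨y, ⟨hy, hys⟩, hyx⟩ := hD.symm ▸ incl_mem_cellAt hx
    exact ⟨y, hy, hys, hyx⟩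
  constructor
  · intro h
    obtain ⟨y, hy, hxy⟩ := (exists_incl_eq_of_eqvGen h).1 x rfl
    have hyS : T.incl j y ∈ S := hxy ▸ hx
    refine ⟨T.discAt S j y, discAt_mem hyS, fun D hD => ⟨fun h' => ?_, ?_⟩⟩
    · obtain ⟨y', hy', hys', hyx'⟩ := key D hD h'
      have : y = y' := by
        refine eq_of_incl_eq hrev (hxy.symm.trans hyx'.symm) (hy.trans hys'.symm) ?_
        have := congrArg T.suppCard hxy
        rw [suppCard_incl, suppCard_incl] at this
        omega
      rw [this]
      exact (eq_discAt_of_mem hD hy').1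
    · rintro rfl
      simp only at hy
      rw [← hy, cellAt_eq_image (discAt_mem hyS) (mem_discAt hyS)]
      exact (cellAt_eq_of_incl_eq hS hxy hx).symm
  · intro D hD h'
    obtain ⟨y', -, hys', hyx'⟩ := key D hD h'
    rw [← hys']
    exact edgeGlued_supp hyx'.symm

open Classical in
-- Exactly one disc in each of the d members of the class of simplices contributes, each time with
-- the same weight 1/d.
theorem sum_weight_cell (hrev : ∀ q : Flag n, ¬ T.FlagEquiv q q.rev) (hS : T.IsNormalSurface S) {k : ℕ}
    {C : Set T.Space} (hC : C ∈ T.cells S k) :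
    ∑ q ∈ (Finset.univ : Finset (Fin n)) ×ˢ Finset.powersetCard (k + 2) (Finset.univ : Finset (Fin 4)),
      ∑ D ∈ (hS q.1).1.toFinset,
        (if T.incl q.1 '' {y ∈ D | supp y = q.2} = C then 1 / (T.edgeDegree q.1 q.2 : ℝ) else 0) = 1 := by
  obtain ⟨i, x, hx, hc, rfl⟩ := mem_cells_iff.1 hC
  have hd : (0 : ℝ) < T.edgeDegree i (supp x) := by exact_mod_cast T.edgeDegree_pos i (supp x)
  have h1 : ∀ q : Fin n × Finset (Fin 4), ∑ D ∈ (hS q.1).1.toFinset,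
        (if T.incl q.1 '' {y ∈ D | supp y = q.2} = T.cellAt S (i, x) then
          1 / (T.edgeDegree q.1 q.2 : ℝ) else 0) =
      if Relation.EqvGen T.EdgeGlued (i, supp x) q then 1 / (T.edgeDegree i (supp x) : ℝ) else 0 := by
    rintro ⟨j, s⟩
    obtain ⟨h1, h2⟩ := exists_disc_of_cell hrev hS hx (by omega : 2 ≤ (supp x).card) (j := j) (s := s)
    split_ifs with h
    · obtain ⟨D₀, hD₀, hD⟩ := h1 h
      rw [Finset.sum_eq_single D₀, if_pos ((hD D₀ hD₀).2 rfl), edgeDegree_eq h]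
      · intro D hD' hne
        rw [if_neg fun h => hne ((hD D ((hS j).1.mem_toFinset.1 hD')).1 h)]
      · intro h
        exact absurd ((hS j).1.mem_toFinset.2 hD₀) h
    · refine Finset.sum_eq_zero fun D hD => if_neg fun h' => h (h2 D ((hS j).1.mem_toFinset.1 hD) h')
  rw [Finset.sum_congr rfl fun q _ => h1 q, ← Finset.sum_filter, Finset.sum_const, nsmul_eq_mul]
  -- Identified simplices have equally many vertices, so restricting to sets of size k + 2 loses no
  -- member of the class.
  have h2 : (Finset.filter (fun q => Relation.EqvGen T.EdgeGlued (i, supp x) q)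
      ((Finset.univ : Finset (Fin n)) ×ˢ Finset.powersetCard (k + 2) Finset.univ)).card =
      T.edgeDegree i (supp x) := by
    rw [edgeDegree, ← Set.ncard_coe_finset]
    congr 1
    ext ⟨j, s⟩
    simp only [Finset.coe_filter, Finset.mem_product, Finset.mem_univ, true_and, Finset.mem_powersetCard,
      Finset.subset_univ, mem_ofPred_eq]
    refine ⟨fun h => h.2, fun h => ⟨?_, h⟩⟩
    obtain ⟨y, hy, hxy⟩ := (exists_incl_eq_of_eqvGen h).1 x rfl
    have := congrArg T.suppCard hxy
    rw [suppCard_incl, suppCard_incl, hy, hc] at this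
    exact this.symm
  rw [h2, mul_one_div_cancel hd.ne']

open Classical in
-- Double counting: each cell is replaced by its total weight 1 and the sums are exchanged. A disc
-- and a simplex then contribute to the single cell that they define, if they meet.
theorem ncard_cells_eq_sum (hrev : ∀ q : Flag n, ¬ T.FlagEquiv q q.rev) (hS : T.IsNormalSurface S)
    (k : ℕ) : ((T.cells S k).ncard : ℝ) =
    ∑ q ∈ (Finset.univ : Finset (Fin n)) ×ˢ Finset.powersetCard (k + 2) (Finset.univ : Finset (Fin 4)),
      ∑ D ∈ (hS q.1).1.toFinset,
        (if {y ∈ D | supp y = q.2}.Nonempty then 1 / (T.edgeDegree q.1 q.2 : ℝ) else 0) := by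
  have hfin := finite_cells hS k
  have h1 : ((T.cells S k).ncard : ℝ) = ∑ C ∈ hfin.toFinset, 1 := by
    rw [Finset.sum_const, nsmul_eq_mul, mul_one, Set.ncard_eq_toFinset_card _ hfin]
  rw [h1, Finset.sum_congr rfl fun C hC => (sum_weight_cell hrev hS (hfin.mem_toFinset.1 hC)).symm,
    Finset.sum_comm]
  refine Finset.sum_congr rfl fun q hq => ?_
  rw [Finset.sum_comm]
  refine Finset.sum_congr rfl fun D hD => ?_
  rw [Finset.sum_ite_eq]
  refine if_congr ?_ rfl rfl
  rw [hfin.mem_toFinset]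
  constructor
  · rintro ⟨h, -⟩
    exact h.of_image
  · intro h
    exact ⟨h.image _, q.1, D, (hS q.1).1.mem_toFinset.1 hD, q.2,
      (Finset.mem_powersetCard.1 (Finset.mem_product.1 hq).2).2, rfl⟩

/-- The number of `k`-dimensional cells of a normal surface, in terms of its vector representation. -/
theorem ncard_cells (hrev : ∀ q : Flag n, ¬ T.FlagEquiv q q.rev) (hS : T.IsNormalSurface S) (k : ℕ) :
    ((T.cells S k).ncard : ℝ) =
      ∑ i, ∑ τ : DiscType, ∑ s ∈ Finset.powersetCard (k + 2) (Finset.univ : Finset (Fin 4)),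
        if τ.Meets s then 1 / (T.edgeDegree i s : ℝ) * T.vectorRep S (i, τ) else 0 := by
  classical
  rw [ncard_cells_eq_sum hrev hS, Finset.sum_product]
  refine Finset.sum_congr rfl fun i _ => ?_
  rw [Finset.sum_comm (s := (Finset.univ : Finset DiscType))]
  refine Finset.sum_congr rfl fun s _ => ?_
  have hv : ∀ τ, T.vectorRep S (i, τ) = ∑ D ∈ (hS i).1.toFinset, if IsNormalDisc τ D then (1 : ℝ) else 0 := by
    intro τ
    rw [Finset.sum_boole, vectorRep, ← Set.ncard_coe_finset]
    congr 2
    ext D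
    simp
  have h1 : ∀ τ : DiscType, (if τ.Meets s then 1 / (T.edgeDegree i s : ℝ) * T.vectorRep S (i, τ) else 0) =
      ∑ D ∈ (hS i).1.toFinset,
        if IsNormalDisc τ D ∧ τ.Meets s then 1 / (T.edgeDegree i s : ℝ) else 0 := by
    intro τ
    rw [hv, Finset.mul_sum]
    by_cases h : τ.Meets s
    · simp [h]
    · simp [h]
  rw [Finset.sum_congr rfl fun τ _ => h1 τ, Finset.sum_comm]
  refine Finset.sum_congr rfl fun D hD => ?_
  obtain ⟨τ, hτ⟩ := (hS i).2 D ((hS i).1.mem_toFinset.1 hD)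
  -- Each disc has exactly one type, so the sum over types collapses.
  rw [Finset.sum_eq_single τ]
  · refine if_congr ?_ rfl rfl
    rw [hτ.nonempty_iff_meets s]
    exact ⟨fun h => ⟨hτ, h⟩, fun h => h.2⟩
  · intro τ' _ hne
    exact if_neg fun h => hne (h.1.type_unique hτ)
  · intro h
    exact absurd (Finset.mem_univ τ) h

/-! ### The explicit sums as weighted counts over simplices -/

variable (T) in
-- The sets of three vertices are the complements of single vertices, and the side weights are
-- reciprocal degrees of faces; this matches the general count of cells.
theorem edgeSum_eq (x : Fin n × DiscType → ℝ) : T.edgeSum x =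
    ∑ i, ∑ τ : DiscType, ∑ s ∈ Finset.powersetCard 3 (Finset.univ : Finset (Fin 4)),
      if τ.Meets s then 1 / (T.edgeDegree i s : ℝ) * x (i, τ) else 0 := by
  have h3 : Finset.powersetCard 3 (Finset.univ : Finset (Fin 4)) =
      Finset.univ.image fun f : Fin 4 => ({f}ᶜ : Finset (Fin 4)) := by decide
  refine Finset.sum_congr rfl fun i _ => Finset.sum_congr rfl fun τ _ => ?_
  rw [h3, Finset.sum_image fun f _ g _ h => by simpa using h]
  refine Finset.sum_congr rfl fun f _ => ?_
  rw [edgeDegree_compl_singleton]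
  by_cases hg : T.glue i f = none
  · simp [hg]
  · simp [hg]

variable (T) in
-- Every disc meets the interior of its tetrahedron, which is identified with nothing else, so all
-- weights are 1.
theorem faceSum_eq (x : Fin n × DiscType → ℝ) : T.faceSum x =
    ∑ i, ∑ τ : DiscType, ∑ s ∈ Finset.powersetCard 4 (Finset.univ : Finset (Fin 4)),
      if τ.Meets s then 1 / (T.edgeDegree i s : ℝ) * x (i, τ) else 0 := by
  have h4 : Finset.powersetCard 4 (Finset.univ : Finset (Fin 4)) = {Finset.univ} := by decide
  have hm : ∀ τ : DiscType, τ.Meets Finset.univ := by decide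
  refine Finset.sum_congr rfl fun i _ => Finset.sum_congr rfl fun τ _ => ?_
  rw [h4, Finset.sum_singleton, if_pos (hm τ), edgeDegree_univ]
  simp

variable (T) in
/-- The linear function that computes the Euler characteristic of normal surfaces. -/
def eulerMap : (Fin n × DiscType → ℝ) →ₗ[ℝ] ℝ where
  toFun x := T.vertexSum x - T.edgeSum x + T.faceSum x
  map_add' x y := by
    have h : ∀ (c : Prop) [Decidable c] (a b d : ℝ),
        (if c then a * (b + d) else 0) = (if c then a * b else 0) + if c then a * d else 0 := by
      intro c _ a b d; split_ifs <;> ring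
    simp only [vertexSum, edgeSum, faceSum, Pi.add_apply, h, Finset.sum_add_distrib]
    ring
  map_smul' r x := by
    have h : ∀ (c : Prop) [Decidable c] (a b : ℝ),
        (if c then a * (r * b) else 0) = r * (if c then a * b else 0) := by
      intro c _ a b; split_ifs <;> ring
    simp only [vertexSum, edgeSum, faceSum, Pi.smul_apply, smul_eq_mul, h, ← Finset.mul_sum,
      RingHom.id_apply]
    ring

end Triangulation

end

end NormalSurface

theorem mainTheorem10 (n : ℕ) (T : NormalSurface.Triangulation n)
    (hT : Nonempty (ChartedSpace (EuclideanHalfSpace 3) T.Space)) :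
    ∃ χ : (Fin n × NormalSurface.DiscType → ℝ) →ₗ[ℝ] ℝ,
      (∀ x, χ x = T.vertexSum x - T.edgeSum x + T.faceSum x) ∧
      ∀ S : Set T.Space, T.IsNormalSurface S →
        NormalSurface.IsPolygonalDecomposition S (T.cells S 0) (T.cells S 1) (T.cells S 2) ∧
        χ (T.vectorRep S) =
          (NormalSurface.eulerCharacteristic (T.cells S 0) (T.cells S 1) (T.cells S 2) : ℝ) := by
  -- The manifold hypothesis enters only through the absence of reversed edges.
  have hrev := NormalSurface.Triangulation.not_flagEquiv_rev hT
  refine ⟨T.eulerMap, fun x => rfl, fun S hS =>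
    ⟨NormalSurface.Triangulation.isPolygonalDecomposition_cells hrev hS, ?_⟩⟩
  change T.vertexSum _ - T.edgeSum _ + T.faceSum _ = _
  rw [NormalSurface.eulerCharacteristic, T.edgeSum_eq, T.faceSum_eq,
    ← NormalSurface.Triangulation.ncard_cells hrev hS 1,
    ← NormalSurface.Triangulation.ncard_cells hrev hS 2]
  push_cast
  rw [NormalSurface.Triangulation.ncard_cells hrev hS 0]
  rfl
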